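/- Let $\mathcal W$ be the space of pairs $p=(w,M)$, where $M\in G=SL(2,\mathbb C)$ and $w=(\phi,\psi):\mathbb R\to\mathbb C^2$ is a smooth row-vector valued function with $w(x+2\pi)=w(x)M$ for all $x$; $G$ acts on the right by $(w,M)\cdot g=(wg,\,g^{-1}Mg)$. Let $e,f,h$ be the standard generators of $\mathfrak g=\mathfrak{sl}(2)$, and put $$r=e\otimes f-f\otimes e,\qquad t=\tfrac12 h\otimes h+e\otimes f+f\otimes e,\qquad r_\pm=r\pm t ,$$ viewed as $4\times4$ matrices; write $A_1=A\otimes1$, $A_2=1\otimes A$ and $\{A_1,B_2\}_{(ij),(kl)}=\{A_{ik},B_{jl}\}$. Let $\mathcal A$ be an algebra of differentiable functionals on $\mathcal W$ (with complex-linear differentials) which contains the matrix coefficients of $M$ and the smeared evaluation functionals $\int f(x)w_k(x)\,dx$, $f\in C_c^\infty(\mathbb R,\mathbb C)$. Let $\{\,,\}$ be a Poisson bracket on $\mathcal A$ for which every observable has a Hamiltonian vector field on $\mathcal W$ and which satisfies, in the sense of distributions in $x,y$ for $|x-y|<2\pi$, the exchange relations $$\{w_1(x),w_2(y)\}=w_1(x)w_2(y)R(x-y),\qquad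 R(x-y)=a(x-y)I+\operatorname{sign}(x-y)\begin{pmatrix}0&0&0&0\\0&1&-1&0\\0&-1&1&0\\0&0&0&0\end{pmatrix}+r,$$ where $a$ is any distribution on $(-2\pi,2\pi)$. Then: 1. As an identity of distributions in $x$, and also pointwise in $x$ for the variation of $w(x)$ under the Hamiltonian vector fields of the matrix coefficients of $M$, $$\{w(x)_1,M_2\}=w(x)_1\bigl[M_2r_+-r_-M_2\bigr].$$ 2. $\{M_1,M_2\}=M_1M_2r+rM_1M_2-M_2r_+M_1-M_1r_-M_2.$ 3. Let $G^*=\{(b_+,b_-)\in B_+\times B_-:\ \operatorname{diag}b_+\cdot\operatorname{diag}b_-=I\}$ ($B_\pm\subset G$ the upper and lower triangular subgroups) be the dual Poisson group, with bracket $$\{b_{\pm1},b_{\pm2}\}=[r,b_{\pm1}b_{\pm2}],\qquad \{b_{+1},b_{-2}\}=[r_+,b_{+1}b_{-2}].$$ Then $\mu:(w,M)\mapsto M$ is a Poisson map into $G^*$: for polynomial functions $P,Q$ on $G$, $\{P\circ\mu,Q\circ\mu\}$ is the pull-back under $\mu$ of the bracket of $P,Q$ defined on all of $G$ by the formula in 2,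 and if $M=b_+b_-^{-1}$ with $b=(b_+,b_-)\in G^*$, its value at $(w,M)$ equals the value at $b$ of the $G^*$-bracket of the pull-backs of $P,Q$ under $(b_+,b_-)\mapsto b_+b_-^{-1}$. 4. $\mu$ is the non-abelian moment map of the right action of $G$. Let $\mathfrak g^*=\{(X_+,X_-)\in\mathfrak b_+\oplus\mathfrak b_-:\ \operatorname{diag}X_++\operatorname{diag}X_-=0\}$ ($\mathfrak b_\pm\subset\mathfrak{sl}(2)$ upper and lower triangular) with the pairing $\langle (X_+,X_-),\xi\rangle=\tfrac12\operatorname{tr}\bigl((X_+-X_-)\xi\bigr)$ with $\mathfrak g$. For all $F\in\mathcal A$ and $p=(w,M)\in\mathcal W$ there is $X\in\mathfrak g^*$ with $$\{F,M\}(p)=X_+M-MX_-,\qquad \frac{d}{ds}\Big|_{s=0}F(p\cdot g_s)=\langle X,\xi\rangle$$ for every smooth curve $g_s$ in $G$ with $g_0=1$ and $\dot g_0=\xi$. If $M=b_+b_-^{-1}$ for some $(b_+,b_-)\in G^*$, then $X$ is the unique element of $\mathfrak g^*$ satisfying the first equation; thus $X=\{F,b\}\,b^{-1}$, i.e. the infinitesimal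 action of $\xi$ is $F\mapsto\langle\{F,b\}b^{-1},\xi\rangle$. -/

import Mathlib

open scoped ContDiff Distributions Matrix Kronecker

noncomputable section

namespace WaveFunctions

/-! ### Tensor notation and the standard r-matrix of `𝔰𝔩(2)` -/

/-- `2 × 2` complex matrices. -/
abbrev Mat2 : Type := Matrix (Fin 2) (Fin 2) ℂ

/-- `Mat(2) ⊗ Mat(2) ≃ Mat(4)`; rows and columns are indexed by pairs (11, 12, 21, 22). -/
abbrev Mat4 : Type := Matrix (Fin 2 × Fin 2) (Fin 2 × Fin 2) ℂ

/-- The group `G = SL(2, ℂ)`. -/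
abbrev SL2 : Type := Matrix.SpecialLinearGroup (Fin 2) ℂ

/-- `A₁ = A ⊗ 1`. -/
def leg₁ (A : Mat2) : Mat4 := A ⊗ₖ (1 : Mat2)

/-- `A₂ = 1 ⊗ A`. -/
def leg₂ (A : Mat2) : Mat4 := (1 : Mat2) ⊗ₖ A

/-- The row vector `u₁` times `X ∈ Mat(2) ⊗ Mat(2)`; the result is a row vector in the first factor
and a matrix (with row index `j` and column index `l`) in the second factor. -/
def rowLeg₁ (u : Fin 2 → ℂ) (X : Mat4) (k j l : Fin 2) : ℂ := ∑ i, u i * X (i, j) (k, l)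

def hMat : Mat2 := !![1, 0; 0, -1]
def eMat : Mat2 := !![0, 1; 0, 0]
def fMat : Mat2 := !![0, 0; 1, 0]

/-- The standard r-matrix `r = e ∧ f = e ⊗ f - f ⊗ e`. -/
def rMat : Mat4 := eMat ⊗ₖ fMat - fMat ⊗ₖ eMat

/-- The tensor Casimir element `t = ½ h ⊗ h + e ⊗ f + f ⊗ e`. -/
def tMat : Mat4 := (1 / 2 : ℂ) • (hMat ⊗ₖ hMat) + eMat ⊗ₖ fMat + fMat ⊗ₖ eMat

/-- `r₊ = r + t`. -/
def rPlus : Mat4 := rMat + tMat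

/-- `r₋ = r - t`. -/
def rMinus : Mat4 := rMat - tMat

/-- The right-invariant exchange matrix with rows
`(0,0,0,0), (0,1,-1,0), (0,-1,1,0), (0,0,0,0)`, i.e. the identity minus the flip. -/
def cMat : Mat4 := Matrix.of fun p q =>
  (if p = q then 1 else 0) - (if p = (q.2, q.1) then 1 else 0)

/-! ### The space `𝒲` of quasi-periodic plane curves -/

/-- A point of `𝒲`: a smooth plane curve `w : ℝ → ℂ²` (a row vector) together with a monodromy
matrix `M ∈ SL(2, ℂ)` such that `w (x + 2π) = w x M`. -/
@[ext]
structure WaveSpace where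
  w : ℝ → Fin 2 → ℂ
  M : SL2
  smooth : ContDiff ℝ ∞ w
  quasiPeriodic : ∀ x, w (x + 2 * Real.pi) = w x ᵥ* (M : Mat2)

/-- The right action `(w, M) · g = (w g, g⁻¹ M g)` of `G` on `𝒲`. -/
def WaveSpace.act (p : WaveSpace) (g : SL2) : WaveSpace where
  w x := p.w x ᵥ* (g : Mat2)
  M := g⁻¹ * p.M * g
  smooth := by
    rw [contDiff_pi]
    intro i
    have h := contDiff_pi.1 p.smooth
    simp only [Matrix.vecMul, dotProduct, Fin.sum_univ_two]
    exact ((h 0).mul contDiff_const).add ((h 1).mul contDiff_const)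
  quasiPeriodic x := by
    have h : (g : Mat2) * ((g⁻¹ : SL2) : Mat2) = 1 := by
      rw [← Matrix.SpecialLinearGroup.coe_mul, mul_inv_cancel, Matrix.SpecialLinearGroup.coe_one]
    simp only [p.quasiPeriodic, Matrix.SpecialLinearGroup.coe_mul, Matrix.vecMul_vecMul]
    rw [← Matrix.mul_assoc, ← Matrix.mul_assoc, h, Matrix.one_mul]

/-- The tangent space of `𝒲` at `(w, M)`: pairs `(v, N)` satisfying the linearizations of
`w (x + 2π) = w x M` and of `det M = 1`. -/
def tangentSpace (p : WaveSpace) : Submodule ℂ ((ℝ → Fin 2 → ℂ) × Mat2) where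
  carrier := {X | ContDiff ℝ ∞ X.1 ∧
    (∀ x, X.1 (x + 2 * Real.pi) = X.1 x ᵥ* (p.M : Mat2) + p.w x ᵥ* X.2) ∧
    ((p.M⁻¹ : SL2) * X.2 : Mat2).trace = 0}
  add_mem' := by
    rintro X Y ⟨h1, h2, h3⟩ ⟨k1, k2, k3⟩
    refine ⟨h1.add k1, fun x => ?_, ?_⟩
    · simp only [Prod.fst_add, Prod.snd_add, Pi.add_apply, h2, k2, Matrix.add_vecMul,
        Matrix.vecMul_add]
      abel
    · simp only [Prod.snd_add, Matrix.mul_add, Matrix.trace_add, h3, k3, add_zero]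
  zero_mem' := by
    refine ⟨contDiff_const, fun x => ?_, ?_⟩ <;> simp
  smul_mem' := by
    rintro c X ⟨h1, h2, h3⟩
    refine ⟨h1.const_smul c, fun x => ?_, ?_⟩
    · simp only [Prod.smul_fst, Prod.smul_snd, Pi.smul_apply, h2, Matrix.smul_vecMul,
        Matrix.vecMul_smul, smul_add]
    · simp only [Prod.smul_snd, Matrix.mul_smul, Matrix.trace_smul, h3, smul_zero]

/-- `γ` is a smooth curve in `𝒲`. -/
def SmoothCurve (γ : ℝ → WaveSpace) : Prop :=
  ContDiff ℝ ∞ (fun q : ℝ × ℝ => (γ q.1).w q.2) ∧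
    ∀ i j, ContDiff ℝ ∞ (fun s => ((γ s).M : Mat2) i j)

/-- `X = (v, N)` is the velocity of the curve `γ` at `s = 0`. -/
def HasVelocity (γ : ℝ → WaveSpace) (X : (ℝ → Fin 2 → ℂ) × Mat2) : Prop :=
  (∀ x, HasDerivAt (fun s => (γ s).w x) (X.1 x) 0) ∧
    ∀ i j, HasDerivAt (fun s => ((γ s).M : Mat2) i j) (X.2 i j) 0

/-- `D` is the differential of the functional `F` at `p`: it gives the derivative of `F` along
every smooth curve through `p`. -/
def HasDifferentialAt (F : WaveSpace → ℂ) (p : WaveSpace) (D : tangentSpace p →ₗ[ℂ] ℂ) : Prop :=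
  ∀ (γ : ℝ → WaveSpace) (X : tangentSpace p), SmoothCurve γ → γ 0 = p → HasVelocity γ X →
    HasDerivAt (fun s => F (γ s)) (D X) 0

/-! ### Observables and Poisson brackets -/

/-- Smooth compactly supported functions `ℝ → ℂ`. -/
abbrev Test : Type := 𝓓((⊤ : TopologicalSpace.Opens ℝ), ℂ)

/-- The evaluation functional `w_k(x)` smeared with `f`, i.e. `∫ f(x) w_k(x) dx`. -/
def smeared (f : Test) (k : Fin 2) (p : WaveSpace) : ℂ := ∫ x, f x * p.w x k

/-- The matrix coefficient `M_{ij}` of the monodromy. -/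
def monodromyCoeff (i j : Fin 2) (p : WaveSpace) : ℂ := (p.M : Mat2) i j

/-- Admissible algebras of observables on `𝒲`: they consist of differentiable functionals and
contain the smeared evaluation functionals and the matrix coefficients of the monodromy. -/
structure IsObservableAlgebra (𝒜 : Subalgebra ℂ (WaveSpace → ℂ)) : Prop where
  differentiable : ∀ F ∈ 𝒜, ∀ p, ∃ D : tangentSpace p →ₗ[ℂ] ℂ, HasDifferentialAt F p D
  smeared_mem : ∀ f k, smeared f k ∈ 𝒜
  monodromyCoeff_mem : ∀ i j, monodromyCoeff i j ∈ 𝒜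

/-- A Poisson bracket on an algebra of observables: a Lie bracket which is a derivation in each
argument and such that every observable has a Hamiltonian vector field. -/
structure PoissonBracket (𝒜 : Subalgebra ℂ (WaveSpace → ℂ)) where
  bracket : 𝒜 →ₗ[ℂ] 𝒜 →ₗ[ℂ] 𝒜
  skew : ∀ F H, bracket F H = -bracket H F
  leibniz : ∀ F H K, bracket F (H * K) = bracket F H * K + H * bracket F K
  jacobi : ∀ F H K,
    bracket F (bracket H K) + bracket H (bracket K F) + bracket K (bracket F H) = 0
  hamiltonian : ∀ (H : 𝒜) (p : WaveSpace), ∃ X : tangentSpace p,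
    ∀ (F : 𝒜) (D : tangentSpace p →ₗ[ℂ] ℂ), HasDifferentialAt F.1 p D →
      (bracket F H).1 p = D X

/-- `X` is the value at `p` of the Hamiltonian vector field `{·, H}`. -/
def PoissonBracket.IsHamiltonianVector {𝒜 : Subalgebra ℂ (WaveSpace → ℂ)} (B : PoissonBracket 𝒜)
    (H : 𝒜) (p : WaveSpace) (X : tangentSpace p) : Prop :=
  ∀ (F : 𝒜) (D : tangentSpace p →ₗ[ℂ] ℂ), HasDifferentialAt F.1 p D →
    (B.bracket F H).1 p = D X

/-! ### The exchange bracket -/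

/-- The interval `(-2π, 2π)`. -/
def window : TopologicalSpace.Opens ℝ := ⟨Set.Ioo (-(2 * Real.pi)) (2 * Real.pi), isOpen_Ioo⟩

/-- `x - y` lies in `(-2π, 2π)` for `x` in the support of `f` and `y` in the support of `g`. -/
def InWindow (f g : Test) : Prop :=
  ∀ x ∈ tsupport f, ∀ y ∈ tsupport g, x - y ∈ window

theorem contDiff_test_mul (f : Test) (p : WaveSpace) (k : Fin 2) :
    ContDiff ℝ ∞ (fun x => f x * p.w x k) :=
  f.contDiff.mul (contDiff_pi.1 p.smooth k)

theorem hasCompactSupport_test_mul (f : Test) (p : WaveSpace) (k : Fin 2) :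
    HasCompactSupport (fun x => f x * p.w x k) :=
  f.hasCompactSupport.mul_right

theorem contDiff_correlation (p : WaveSpace) (f g : Test) (k l : Fin 2) :
    ContDiff ℝ ∞ (fun z : ℝ => ∫ y, (f (y + z) * p.w (y + z) k) * (g y * p.w y l)) := by
  have hg := contDiff_test_mul g p l
  have key := (hasCompactSupport_test_mul f p k).contDiff_convolution_right
    (μ := MeasureTheory.volume) (n := ⊤) (ContinuousLinearMap.mul ℝ ℂ)
    (f := fun t => g (-t) * p.w (-t) l)
    ((hg.continuous.comp continuous_neg).locallyIntegrable) (contDiff_test_mul f p k)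
  refine (congrArg (ContDiff ℝ ∞) (funext fun z => ?_)).mp key
  simp only [MeasureTheory.convolution, ContinuousLinearMap.mul_apply']
  rw [← MeasureTheory.integral_neg_eq_self]
  refine MeasureTheory.integral_congr_ae (Filter.Eventually.of_forall fun y => ?_)
  simp only [neg_neg, sub_neg_eq_add]
  rw [mul_comm, add_comm]

theorem isCompact_differences (f g : Test) :
    IsCompact ((fun q : ℝ × ℝ => q.1 - q.2) '' (tsupport f ×ˢ tsupport g)) :=
  (f.hasCompactSupport.isCompact.prod g.hasCompactSupport.isCompact).image
    (continuous_fst.sub continuous_snd)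

theorem tsupport_correlation_subset (p : WaveSpace) (f g : Test) (k l : Fin 2) :
    tsupport (fun z : ℝ => ∫ y, (f (y + z) * p.w (y + z) k) * (g y * p.w y l)) ⊆
      (fun q : ℝ × ℝ => q.1 - q.2) '' (tsupport f ×ˢ tsupport g) := by
  refine closure_minimal (fun z hz => ?_) (isCompact_differences f g).isClosed
  by_contra hn
  refine hz (MeasureTheory.integral_eq_zero_of_ae (Filter.Eventually.of_forall fun y => ?_))
  by_cases h1 : y + z ∈ tsupport f
  · by_cases h2 : y ∈ tsupport g
    · exact absurd ⟨(y + z, y), ⟨h1, h2⟩, by simp⟩ hn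
    · simp [image_eq_zero_of_notMem_tsupport h2]
  · simp [image_eq_zero_of_notMem_tsupport h1]

/-- The test function `z ↦ ∫ f(y+z) w_k(y+z) g(y) w_l(y) dy` on `(-2π, 2π)`. -/
def correlation (p : WaveSpace) (f g : Test) (hfg : InWindow f g) (k l : Fin 2) :
    𝓓(window, ℂ) where
  toFun z := ∫ y, (f (y + z) * p.w (y + z) k) * (g y * p.w y l)
  contDiff' := contDiff_correlation p f g k l
  hasCompactSupport' := HasCompactSupport.of_support_subset_isCompact (isCompact_differences f g)
    ((subset_tsupport _).trans (tsupport_correlation_subset p f g k l))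
  tsupport_subset' := by
    refine (tsupport_correlation_subset p f g k l).trans ?_
    rintro _ ⟨q, ⟨h1, h2⟩, rfl⟩
    exact hfg _ h1 _ h2

/-- The exchange relations `{w₁(x), w₂(y)} = w₁(x) w₂(y) R(x - y)`, `|x - y| < 2π`, with exchange
matrix `R(x - y) = a(x - y) I + sign(x - y) c + r`, where `c` is the right-invariant exchange matrix
`cMat` and `a` is a distribution. They are understood in the sense of distributions in `x`, `y`.
For `|x - y| > 2π` the brackets follow from these by quasi-periodicity. The oddness of `a` need not
be required: it is forced by the skew-symmetry of the bracket. -/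
def PoissonBracket.HasExchangeRelations {𝒜 : Subalgebra ℂ (WaveSpace → ℂ)} (B : PoissonBracket 𝒜)
    (h𝒜 : IsObservableAlgebra 𝒜) (a : 𝓓(window, ℂ) →L[ℂ] ℂ) : Prop :=
  ∀ (f g : Test) (hfg : InWindow f g) (k l : Fin 2) (p : WaveSpace),
    (B.bracket ⟨smeared f k, h𝒜.smeared_mem f k⟩ ⟨smeared g l, h𝒜.smeared_mem g l⟩).1 p =
      a (correlation p f g hfg k l) +
      ∫ x, ∫ y, f x * g y * ∑ i, ∑ j, p.w x i * p.w y j *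
        (((Real.sign (x - y) : ℝ) : ℂ) • cMat + rMat) (i, j) (k, l)

/-! ### The dual Poisson group `G*` -/

/-- `G* = {(b₊, b₋) ∈ B₊ × B₋ | diag b₊ · diag b₋ = 1}`, where `B₊`, `B₋` are the subgroups of
upper and lower triangular matrices. -/
def dualGroup : Subgroup (SL2 × SL2) where
  carrier := {b | b.1 1 0 = 0 ∧ b.2 0 1 = 0 ∧ ∀ i, b.1 i i * b.2 i i = 1}
  mul_mem' := by
    rintro b c ⟨h1, h2, h3⟩ ⟨k1, k2, k3⟩
    refine ⟨?_, ?_, ?_⟩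
    · simp [Matrix.mul_apply, Fin.sum_univ_two, h1, k1]
    · simp [Matrix.mul_apply, Fin.sum_univ_two, h2, k2]
    · have := h3 0
      have := h3 1
      have := k3 0
      have := k3 1
      intro i
      fin_cases i <;> simp [Matrix.mul_apply, Fin.sum_univ_two, h1, k1, h2, k2] <;> grind
  one_mem' := by
    refine ⟨?_, ?_, ?_⟩ <;> simp
  inv_mem' := by
    rintro b ⟨h1, h2, h3⟩
    have h0 := h3 0
    have h1' := h3 1
    refine ⟨?_, ?_, ?_⟩
    · simp [Matrix.SpecialLinearGroup.coe_inv, Matrix.adjugate_fin_two, h1]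
    · simp [Matrix.SpecialLinearGroup.coe_inv, Matrix.adjugate_fin_two, h2]
    · intro i
      fin_cases i <;> simp [Matrix.SpecialLinearGroup.coe_inv, Matrix.adjugate_fin_two, h0, h1']

/-- The map `G* → G`, `(b₊, b₋) ↦ b₊ b₋⁻¹`. -/
def factorMap (b : dualGroup) : SL2 := b.1.1 * b.1.2⁻¹

/-- The Lie algebra `𝔤* = {(X₊, X₋) ∈ 𝔟₊ ⊕ 𝔟₋ | diag X₊ + diag X₋ = 0}` of `G*`. -/
def dualLie : Submodule ℂ (Mat2 × Mat2) where
  carrier := {X | X.1.trace = 0 ∧ X.2.trace = 0 ∧ X.1 1 0 = 0 ∧ X.2 0 1 = 0 ∧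
    ∀ i, X.1 i i + X.2 i i = 0}
  add_mem' := by
    rintro X Y ⟨h1, h2, h3, h4, h5⟩ ⟨k1, k2, k3, k4, k5⟩
    refine ⟨by simp [h1, k1], by simp [h2, k2], by simp [h3, k3], by simp [h4, k4], fun i => ?_⟩
    have := h5 i
    have := k5 i
    simp only [Prod.fst_add, Prod.snd_add, Matrix.add_apply]
    grind
  zero_mem' := by
    refine ⟨?_, ?_, ?_, ?_, ?_⟩ <;> simp
  smul_mem' := by
    rintro c X ⟨h1, h2, h3, h4, h5⟩
    refine ⟨by simp [h1], by simp [h2], by simp [h3], by simp [h4], fun i => ?_⟩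
    simp [← mul_add, h5 i]

/-- The pairing `⟨(X₊, X₋), ξ⟩ = ½ tr ((X₊ - X₋) ξ)` which identifies `𝔤*` (as a Lie algebra of
pairs of matrices) with the dual of `𝔤 = 𝔰𝔩(2)`, the Lie bracket on the dual being the
linearization at the unit of the Sklyanin bracket `{g₁, g₂} = [r, g₁ g₂]`. -/
def dualPairing (X : Mat2 × Mat2) (ξ : Mat2) : ℂ := (1 / 2 : ℂ) * ((X.1 - X.2) * ξ).trace

/-- The biderivation of a polynomial ring determined by its values `π m n` on the coordinates,
evaluated at the point `x`. -/
def biderivation {σ : Type} [Fintype σ] (π : σ → σ → ℂ) (x : σ → ℂ) (P Q : MvPolynomial σ ℂ) : ℂ :=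
  ∑ m, ∑ n, MvPolynomial.eval x (MvPolynomial.pderiv m P) *
    MvPolynomial.eval x (MvPolynomial.pderiv n Q) * π m n

/-- Matrix entry indices. -/
abbrev Entry : Type := Fin 2 × Fin 2

/-- The entries of a tensor bracket `{A₁, B₂} = X`: `{A_{ik}, B_{jl}} = X_{(ij),(kl)}`. -/
def entries (X : Mat4) (m n : Entry) : ℂ := X (m.1, n.1) (m.2, n.2)

/-- The commutator in `Mat(4)`. -/
def comm (X Y : Mat4) : Mat4 := X * Y - Y * X

/-- Coordinates on `G*`: the matrix coefficients of `b₊` (`Sum.inl`) and of `b₋` (`Sum.inr`). -/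
def dualCoord (b : dualGroup) : Entry ⊕ Entry → ℂ
  | .inl m => (b.1.1 : Mat2) m.1 m.2
  | .inr m => (b.1.2 : Mat2) m.1 m.2

/-- The multiplicative Poisson bracket of the dual Poisson group `G*`:
`{b₊₁, b₊₂} = [r, b₊₁ b₊₂]`, `{b₋₁, b₋₂} = [r, b₋₁ b₋₂]`, `{b₊₁, b₋₂} = [r₊, b₊₁ b₋₂]`. -/
def dualBivector (b : dualGroup) : Entry ⊕ Entry → Entry ⊕ Entry → ℂ
  | .inl m, .inl n => entries (comm rMat ((b.1.1 : Mat2) ⊗ₖ (b.1.1 : Mat2))) m n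
  | .inr m, .inr n => entries (comm rMat ((b.1.2 : Mat2) ⊗ₖ (b.1.2 : Mat2))) m n
  | .inl m, .inr n => entries (comm rPlus ((b.1.1 : Mat2) ⊗ₖ (b.1.2 : Mat2))) m n
  | .inr m, .inl n => -entries (comm rPlus ((b.1.1 : Mat2) ⊗ₖ (b.1.2 : Mat2))) n m

/-- The right-hand side `M₁M₂ r + r M₁M₂ - M₂ r₊ M₁ - M₁ r₋ M₂` of the dual Poisson bracket
transported to `G`. -/
def dualTensor (M : Mat2) : Mat4 :=
  leg₁ M * leg₂ M * rMat + rMat * leg₁ M * leg₂ M - leg₂ M * rPlus * leg₁ M -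
    leg₁ M * rMinus * leg₂ M

/-- The entries of `b₊ b₋⁻¹` as polynomials in the coordinates on `G*`
(the inverse being the adjugate, as `det b₋ = 1`). -/
def factorPoly (m : Entry) : MvPolynomial (Entry ⊕ Entry) ℂ :=
  let bPlus : Matrix (Fin 2) (Fin 2) (MvPolynomial (Entry ⊕ Entry) ℂ) :=
    Matrix.of fun i j => MvPolynomial.X (Sum.inl (i, j))
  let bMinus : Matrix (Fin 2) (Fin 2) (MvPolynomial (Entry ⊕ Entry) ℂ) :=
    Matrix.of fun i j => MvPolynomial.X (Sum.inr (i, j))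
  (bPlus * bMinus.adjugate) m.1 m.2

/-- The matrix coefficient `M_{ij}` as an element of the algebra of observables. -/
def monodromyObs {𝒜 : Subalgebra ℂ (WaveSpace → ℂ)} (h𝒜 : IsObservableAlgebra 𝒜) (m : Entry) : 𝒜 :=
  ⟨monodromyCoeff m.1 m.2, h𝒜.monodromyCoeff_mem m.1 m.2⟩

/-- The pull-back `P ∘ μ` of a polynomial function `P` on `G` under `μ : (w, M) ↦ M`. -/
def pullback {𝒜 : Subalgebra ℂ (WaveSpace → ℂ)} (h𝒜 : IsObservableAlgebra 𝒜)
    (P : MvPolynomial Entry ℂ) : 𝒜 :=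
  MvPolynomial.aeval (monodromyObs h𝒜) P

/-- `μ : (w, M) ↦ M` is a Poisson map. First, into `G` with the (everywhere defined) dual Poisson
bracket `{M₁, M₂} = M₁M₂ r + r M₁M₂ - M₂ r₊ M₁ - M₁ r₋ M₂`; secondly, over the image of
`G* → G`, into `G*` itself: the bracket of pull-backs under `μ` is the bracket on `G*` of the
pull-backs under `(b₊, b₋) ↦ b₊ b₋⁻¹`. -/
def PoissonBracket.IsPoissonMapToDual {𝒜 : Subalgebra ℂ (WaveSpace → ℂ)} (B : PoissonBracket 𝒜)
    (h𝒜 : IsObservableAlgebra 𝒜) : Prop :=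
  (∀ (P Q : MvPolynomial Entry ℂ) (p : WaveSpace),
    (B.bracket (pullback h𝒜 P) (pullback h𝒜 Q)).1 p =
      biderivation (entries (dualTensor p.M)) (fun m => (p.M : Mat2) m.1 m.2) P Q) ∧
  (∀ (P Q : MvPolynomial Entry ℂ) (p : WaveSpace) (b : dualGroup), factorMap b = p.M →
    (B.bracket (pullback h𝒜 P) (pullback h𝒜 Q)).1 p =
      biderivation (dualBivector b) (dualCoord b)
        (MvPolynomial.bind₁ factorPoly P) (MvPolynomial.bind₁ factorPoly Q))

/-- `X ∈ 𝔤*` is a lift of the tangent vector `N` at `M ∈ G`. If `M = b₊ b₋⁻¹`, then the tangent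
vector `(X₊ b₊, X₋ b₋)` of `G*` at `(b₊, b₋)`, whose right logarithmic derivative is `X`, is mapped
to `X₊ M - M X₋` by the differential of `(b₊, b₋) ↦ b₊ b₋⁻¹`. -/
def IsDualLift (M N : Mat2) (X : Mat2 × Mat2) : Prop :=
  X ∈ dualLie ∧ N = X.1 * M - M * X.2

/-- The derivative of `F` at `p` along the right action of `G` in the direction `ξ ∈ 𝔤` is
`c ξ`, for all `ξ`. -/
def HasActionDerivative (F : WaveSpace → ℂ) (p : WaveSpace) (c : Mat2 → ℂ) : Prop :=
  ∀ (g : ℝ → SL2) (ξ : Mat2), (∀ i j, ContDiff ℝ ∞ fun s => (g s : Mat2) i j) → g 0 = 1 →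
    (∀ i j, HasDerivAt (fun s => (g s : Mat2) i j) (ξ i j) 0) →
    HasDerivAt (fun s => F (p.act (g s))) (c ξ) 0

/-- `μ : (w, M) ↦ M` is the non-abelian moment map of the right action of `G`: it is a Poisson map
to `G*`, and the infinitesimal action of `ξ ∈ 𝔤` is `F ↦ ⟨{F, b} b⁻¹, ξ⟩`, where `b = (b₊, b₋)` is
related to `M` by `M = b₊ b₋⁻¹`. That is, the derivative `{F, M}` has a lift `X = {F, b} b⁻¹` to
`𝔤*` with `⟨X, ξ⟩ = (ξ · F)`; the lift is unique wherever `M` belongs to the image of `G*`. -/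
def PoissonBracket.IsMomentMap {𝒜 : Subalgebra ℂ (WaveSpace → ℂ)} (B : PoissonBracket 𝒜)
    (h𝒜 : IsObservableAlgebra 𝒜) : Prop :=
  B.IsPoissonMapToDual h𝒜 ∧
  ∀ (F : 𝒜) (p : WaveSpace),
    (∃ X, IsDualLift p.M (Matrix.of fun i j => (B.bracket F (monodromyObs h𝒜 (i, j))).1 p) X ∧
      HasActionDerivative F.1 p (dualPairing X)) ∧
    (p.M ∈ Set.range factorMap →
      ∃! X, IsDualLift p.M (Matrix.of fun i j => (B.bracket F (monodromyObs h𝒜 (i, j))).1 p) X)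

end WaveFunctions

end

noncomputable section

namespace WaveFunctions

open Filter Topology

/-! The monodromy is reached by moving `y` across one period. If 0 < x - y < 2π, then y and y + 2π
both lie in the window around x, on opposite sides of it, and w(y + 2π) = w(y)M gives {w(x), w(y +
2π)} = {w(x), w(y)}M + w(y){w(x), M}. With P the flip, c = 1 - P and t = P - ½, so that ±c + r = r_∓
± ½. The jump of the sign therefore produces exactly w(x)₁(M₂r₊ - r₋M₂), up to a multiple of w(x) ⊗
w(y)M whose coefficient a(x - y - 2π) - a(x - y) - 1 is not known (`contract_shift`,
`sum_smeared_bracketMonodromy`).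

Pairing with w(y + 2π) by the determinant kills this multiple whatever `a` is. So if K is the
deviation of {w(f), M} from the asserted value, each w(y) is an eigenvector of KM⁻¹
(`deviation_parallel`). This matrix is traceless because det M = 1 and the legs of r_± lie in 𝔰𝔩(2),
hence it vanishes when w takes three pairwise independent values (`eq_zero_of_three_eigenvectors`).
Degenerate curves are limits of good ones along a line in 𝒲, and observables are continuous at the
limit point (`eq_of_eq_inGeneralPosition`). Test functions of small support suffice to find the
Hamiltonian vector field of M_{jl} pointwise, and this removes the support condition.

The field moves w by wL, where L = `firstLeg M j l` is traceless; linearized quasi-periodicity then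
forces M to move by [M, L]. It is thus the infinitesimal action of L, which is the source of all the
rest. The commutator is the bracket of M with itself, because t commutes with M ⊗ M. For an
observable with differential D, put Z = D ∘ `actionVector p`; then {F, M_{jl}} = Z(L), and expanding
r_± turns this into X₊M - MX₋ with X representing Z (`apply_firstLeg`). The comparison with G* is
the chain rule and a check on coordinate functions (`biderivation_factorPoly`). -/

/-! ### Test functions and smeared evaluations -/

/-- The product of a test function with a smooth function. -/
def mulTest (g : Test) (u : ℝ → ℂ) (hu : ContDiff ℝ ∞ u) : Test where
  toFun x := g x * u x
  contDiff' := g.contDiff.mul hu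
  hasCompactSupport' := g.hasCompactSupport.mul_right
  tsupport_subset' := Set.subset_univ _

/-- The translate `x ↦ g (x - 2π)` of a test function. -/
def shiftTest (g : Test) : Test where
  toFun x := g (x - 2 * Real.pi)
  contDiff' := g.contDiff.comp (contDiff_id.sub contDiff_const)
  hasCompactSupport' := g.hasCompactSupport.comp_homeomorph (Homeomorph.subRight (2 * Real.pi))
  tsupport_subset' := Set.subset_univ _

@[simp]
theorem mulTest_apply (g : Test) (u : ℝ → ℂ) (hu : ContDiff ℝ ∞ u) (x : ℝ) :
    mulTest g u hu x = g x * u x := rfl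

@[simp]
theorem shiftTest_apply (g : Test) (x : ℝ) : shiftTest g x = g (x - 2 * Real.pi) := rfl

theorem tsupport_mulTest (g : Test) (u : ℝ → ℂ) (hu : ContDiff ℝ ∞ u) :
    tsupport (mulTest g u hu) ⊆ tsupport g :=
  closure_mono (Function.support_mul_subset_left _ _)

theorem tsupport_shiftTest (g : Test) {x : ℝ} (hx : x ∈ tsupport (shiftTest g)) :
    x - 2 * Real.pi ∈ tsupport g := by
  have h : tsupport (shiftTest g) ⊆ (fun x => x - 2 * Real.pi) ⁻¹' tsupport g :=
    closure_minimal (fun y hy => subset_tsupport g hy)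
      ((isClosed_tsupport g).preimage (continuous_id.sub continuous_const))
  exact h hx

theorem integrable_test_mul (f : Test) {u : ℝ → ℂ} (hu : Continuous u) :
    MeasureTheory.Integrable fun x => f x * u x :=
  (f.continuous.mul hu).integrable_of_hasCompactSupport f.hasCompactSupport.mul_right

theorem continuous_coord (p : WaveSpace) (k : Fin 2) : Continuous fun x => p.w x k :=
  (contDiff_pi.1 p.smooth k).continuous

/-- A continuous function is zero on an open set if it is orthogonal to all test functions which are
supported there. -/
theorem eq_zero_of_integral_test_eq_zero {G : ℝ → ℂ} (hG : Continuous G) {U : Set ℝ} (hU : IsOpen U)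
    (h : ∀ g : Test, tsupport g ⊆ U → ∫ x, g x * G x = 0) {x : ℝ} (hx : x ∈ U) : G x = 0 := by
  have h1 : ∀ᵐ x ∂MeasureTheory.volume, x ∈ U → G x = 0 := by
    refine hU.ae_eq_zero_of_integral_contDiff_smul_eq_zero
      (hG.locallyIntegrable.locallyIntegrableOn U) fun g hg hc hs => ?_
    have hs' : tsupport (fun x => (g x : ℂ)) ⊆ tsupport g :=
      closure_mono fun y hy => by simpa using hy
    let g' : Test :=
      { toFun := fun x => (g x : ℂ)
        contDiff' := Complex.ofRealCLM.contDiff.comp hg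
        hasCompactSupport' := hc.comp_left (g := fun t : ℝ => (t : ℂ)) Complex.ofReal_zero
        tsupport_subset' := Set.subset_univ _ }
    have := h g' (hs'.trans hs)
    rw [← this]
    exact MeasureTheory.integral_congr_ae (Filter.Eventually.of_forall fun y => rfl)
  by_contra hne
  have hV : IsOpen (U ∩ {y | G y ≠ 0}) := hU.inter (isOpen_ne_fun hG continuous_const)
  have h2 : MeasureTheory.volume (U ∩ {y | G y ≠ 0}) = 0 :=
    MeasureTheory.measure_mono_null (t := {y | ¬(y ∈ U → G y = 0)}) (fun y hy hyy => hy.2 (hyy hy.1))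
      h1
  exact (hV.measure_pos MeasureTheory.volume ⟨x, hx, hne⟩).ne' h2

theorem smeared_shiftTest (g : Test) (l : Fin 2) (p : WaveSpace) :
    smeared (shiftTest g) l p = ∑ m, smeared g m p * (p.M : Mat2) m l := by
  unfold smeared
  rw [← MeasureTheory.integral_add_right_eq_self _ (2 * Real.pi)]
  simp only [shiftTest_apply, add_sub_cancel_right, p.quasiPeriodic, Fin.sum_univ_two]
  rw [← MeasureTheory.integral_mul_const, ← MeasureTheory.integral_mul_const,
    ← MeasureTheory.integral_add ((integrable_test_mul g (continuous_coord p 0)).mul_const _)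
      ((integrable_test_mul g (continuous_coord p 1)).mul_const _)]
  congr 1
  funext x
  simp only [Matrix.vecMul, dotProduct, Fin.sum_univ_two]
  ring

/-- The differential of `smeared f k`. -/
def smearedDifferential (f : Test) (k : Fin 2) (p : WaveSpace) : tangentSpace p →ₗ[ℂ] ℂ where
  toFun X := ∫ x, f x * X.1.1 x k
  map_add' X Y := by
    rw [← MeasureTheory.integral_add
      (integrable_test_mul f (contDiff_pi.1 X.2.1 k).continuous)
      (integrable_test_mul f (contDiff_pi.1 Y.2.1 k).continuous)]
    simp [mul_add]
  map_smul' c X := by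
    simp only [Submodule.coe_smul, Prod.smul_fst, Pi.smul_apply, smul_eq_mul, RingHom.id_apply]
    rw [← MeasureTheory.integral_const_mul]
    congr 1
    funext x
    ring

theorem hasDifferentialAt_smeared (f : Test) (k : Fin 2) (p : WaveSpace) :
    HasDifferentialAt (smeared f k) p (smearedDifferential f k p) := by
  intro γ X hγ h0 hX
  have hW : ContDiff ℝ ∞ fun q : ℝ × ℝ => (γ q.1).w q.2 k := contDiff_pi.1 hγ.1 k
  set V : ℝ × ℝ → ℂ := fun q => fderiv ℝ (fun q : ℝ × ℝ => (γ q.1).w q.2 k) q (1, 0) with hV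
  have hVc : Continuous V := (hW.continuous_fderiv (by simp)).clm_apply continuous_const
  have hd : ∀ s x, HasDerivAt (fun s => (γ s).w x k) (V (s, x)) s := fun s x => by
    have h1 : HasFDerivAt (fun q : ℝ × ℝ => (γ q.1).w q.2 k)
        (fderiv ℝ (fun q : ℝ × ℝ => (γ q.1).w q.2 k) (s, x)) (s, x) :=
      (hW.differentiable (by simp)).differentiableAt.hasFDerivAt
    exact h1.comp_hasDerivAt s ((hasDerivAt_id s).prodMk (hasDerivAt_const s x))
  have hV0 : ∀ x, V (0, x) = X.1.1 x k := fun x =>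
    (hd 0 x).unique (hasDerivAt_pi.1 (hX.1 x) k)
  -- Joint smoothness of the curve bounds its velocity on [-1, 1] × supp f, which gives the
  -- dominating function for differentiation under the integral.
  obtain ⟨C, hC⟩ := ((isCompact_Icc (a := (-1 : ℝ)) (b := 1)).prod
    f.hasCompactSupport.isCompact).exists_bound_of_continuousOn hVc.continuousOn
  have key := hasDerivAt_integral_of_dominated_loc_of_deriv_le (μ := MeasureTheory.volume)
    (F := fun s x => f x * (γ s).w x k) (F' := fun s x => f x * V (s, x)) (x₀ := (0 : ℝ))
    (s := Set.Icc (-1) 1) (bound := fun x => ‖f x‖ * C) (Icc_mem_nhds (by norm_num) (by norm_num))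
    (Filter.Eventually.of_forall fun s =>
      (integrable_test_mul f (continuous_coord (γ s) k)).aestronglyMeasurable)
    (integrable_test_mul f (continuous_coord (γ 0) k))
    (integrable_test_mul f (hVc.comp (continuous_const.prodMk continuous_id))).aestronglyMeasurable
    (Filter.Eventually.of_forall fun x s hs => by
      rw [norm_mul]
      by_cases hx : x ∈ tsupport f
      · exact mul_le_mul_of_nonneg_left (hC (s, x) ⟨hs, hx⟩) (norm_nonneg _)
      · simp [image_eq_zero_of_notMem_tsupport hx])
    ((f.continuous.norm.integrable_of_hasCompactSupport f.hasCompactSupport.norm).mul_const C)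
    (Filter.Eventually.of_forall fun x s _ => (hd s x).const_mul (f x))
  have h2 := key.2
  simp only [hV0] at h2
  exact h2

/-- The differential of `monodromyCoeff i j`. -/
def monodromyDifferential (i j : Fin 2) (p : WaveSpace) : tangentSpace p →ₗ[ℂ] ℂ where
  toFun X := X.1.2 i j
  map_add' _ _ := rfl
  map_smul' _ _ := rfl

theorem hasDifferentialAt_monodromyCoeff (i j : Fin 2) (p : WaveSpace) :
    HasDifferentialAt (monodromyCoeff i j) p (monodromyDifferential i j p) :=
  fun _ _ _ _ hX => hX.2 i j

/-! ### Perturbation to curves in general position -/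

/-- A smooth curve with support in the unit interval around `0` which is `t ↦ (1, t)` near `0`. -/
def localLine (t : ℝ) : Fin 2 → ℂ :=
  ((⟨1 / 2, 1, by norm_num, by norm_num⟩ : ContDiffBump (0 : ℝ)) t : ℂ) • ![1, (t : ℂ)]

theorem contDiff_localLine : ContDiff ℝ ∞ localLine := by
  have h1 : ContDiff ℝ ∞ fun t : ℝ => (t : ℂ) := Complex.ofRealCLM.contDiff
  have h2 : ContDiff ℝ ∞ fun t : ℝ =>
      ((⟨1 / 2, 1, by norm_num, by norm_num⟩ : ContDiffBump (0 : ℝ)) t : ℂ) :=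
    h1.comp (ContDiffBump.contDiff _)
  refine contDiff_pi.2 fun i => ?_
  fin_cases i
  · simpa [localLine] using h2
  · simpa [localLine] using h2.mul h1

theorem localLine_of_one_le {t : ℝ} (ht : 1 ≤ |t|) : localLine t = 0 := by
  rw [localLine, ContDiffBump.zero_of_le_dist _ (by simpa using ht)]
  simp

theorem localLine_of_le_half {t : ℝ} (ht : |t| ≤ 1 / 2) : localLine t = ![1, (t : ℂ)] := by
  rw [localLine, ContDiffBump.one_of_mem_closedBall _ (by simpa using ht)]
  simp

/-- The quasi-periodic extension of `localLine`, translated by `c`. -/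
def quasiLine (M : SL2) (c x : ℝ) : Fin 2 → ℂ :=
  localLine (x - c - round ((x - c) / (2 * Real.pi)) * (2 * Real.pi)) ᵥ*
    ((M ^ round ((x - c) / (2 * Real.pi)) : SL2) : Mat2)

/-- The constant 3 is a convenient number below the half period π. -/
theorem round_eq_of_abs_sub_lt {t : ℝ} {n : ℤ} (h : |t - n * (2 * Real.pi)| < 3) :
    round (t / (2 * Real.pi)) = n := by
  have hpi := Real.pi_gt_three
  rw [abs_lt] at h
  rw [round_eq, Int.floor_eq_iff, div_add' _ _ _ (by positivity), le_div_iff₀ (by positivity),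
    div_lt_iff₀ (by positivity)]
  constructor <;> nlinarith

/-- The rounding jumps only at distance π from the lattice, where `localLine` is zero. Locally the
integer may therefore be frozen: if the integers of x and z differ, both sides vanish. Smoothness of
`quasiLine` follows. -/
theorem quasiLine_eq (M : SL2) (c z : ℝ) {x : ℝ} (hx : |x - z| < 1) :
    quasiLine M c x = localLine (x - c - round ((z - c) / (2 * Real.pi)) * (2 * Real.pi)) ᵥ*
      ((M ^ round ((z - c) / (2 * Real.pi)) : SL2) : Mat2) := by
  unfold quasiLine
  by_cases h : round ((x - c) / (2 * Real.pi)) = round ((z - c) / (2 * Real.pi))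
  · rw [h]
  rw [localLine_of_one_le, localLine_of_one_le, Matrix.zero_vecMul, Matrix.zero_vecMul]
  · by_contra! hlt
    exact h (round_eq_of_abs_sub_lt (hlt.trans (by norm_num)))
  · by_contra! hlt
    refine h (round_eq_of_abs_sub_lt ?_).symm
    rw [abs_lt] at *
    constructor <;> linarith

theorem contDiff_quasiLine (M : SL2) (c : ℝ) : ContDiff ℝ ∞ (quasiLine M c) := by
  rw [contDiff_iff_contDiffAt]
  intro z
  have h : ContDiff ℝ ∞ fun x =>
      localLine (x - c - round ((z - c) / (2 * Real.pi)) * (2 * Real.pi)) ᵥ*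
      ((M ^ round ((z - c) / (2 * Real.pi)) : SL2) : Mat2) := by
    have h1 := contDiff_pi.1 (contDiff_localLine.comp ((contDiff_id.sub contDiff_const).sub
      (contDiff_const (c := round ((z - c) / (2 * Real.pi)) * (2 * Real.pi))) :
      ContDiff ℝ ∞ fun x : ℝ => x - c - round ((z - c) / (2 * Real.pi)) * (2 * Real.pi)))
    rw [contDiff_pi]
    intro i
    simp only [Matrix.vecMul, dotProduct, Fin.sum_univ_two]
    exact ((h1 0).mul contDiff_const).add ((h1 1).mul contDiff_const)
  refine h.contDiffAt.congr_of_eventuallyEq ?_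
  filter_upwards [Metric.ball_mem_nhds z one_pos] with x hx
  exact quasiLine_eq M c z (by simpa [Real.dist_eq] using hx)

theorem quasiLine_add (M : SL2) (c x : ℝ) :
    quasiLine M c (x + 2 * Real.pi) = quasiLine M c x ᵥ* (M : Mat2) := by
  have hpi := Real.pi_pos
  have h : round ((x + 2 * Real.pi - c) / (2 * Real.pi)) = round ((x - c) / (2 * Real.pi)) + 1 := by
    rw [← round_add_one]
    congr 1
    field_simp
    ring
  unfold quasiLine
  rw [h, zpow_add_one, Matrix.SpecialLinearGroup.coe_mul, Matrix.vecMul_vecMul]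
  congr 2
  push_cast
  ring

theorem quasiLine_near (M : SL2) (c : ℝ) {x : ℝ} (hx : |x - c| ≤ 1 / 2) :
    quasiLine M c x = ![1, ((x - c : ℝ) : ℂ)] := by
  have h : round ((x - c) / (2 * Real.pi)) = 0 :=
    round_eq_of_abs_sub_lt (by simpa using hx.trans_lt (by norm_num))
  rw [quasiLine, h]
  simp [localLine_of_le_half hx]

/-- The line `s ↦ (w + s u, M)` in `𝒲`, where `u = quasiLine M c`. -/
def perturb (p : WaveSpace) (c s : ℝ) : WaveSpace where
  w x := p.w x + (s : ℂ) • quasiLine p.M c x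
  M := p.M
  smooth := p.smooth.add ((contDiff_quasiLine p.M c).const_smul (s : ℂ))
  quasiPeriodic x := by
    rw [p.quasiPeriodic, quasiLine_add, Matrix.add_vecMul, Matrix.smul_vecMul]

theorem perturb_zero (p : WaveSpace) (c : ℝ) : perturb p c 0 = p := by
  ext <;> simp [perturb]

theorem continuousAt_perturb {F : WaveSpace → ℂ} {p : WaveSpace} {D : tangentSpace p →ₗ[ℂ] ℂ}
    (hF : HasDifferentialAt F p D) (c : ℝ) : ContinuousAt (fun s => F (perturb p c s)) 0 := by
  refine (hF (perturb p c) ⟨(quasiLine p.M c, 0), contDiff_quasiLine p.M c, fun x => ?_, ?_⟩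
    ⟨?_, fun i j => contDiff_const (c := (p.M : Mat2) i j)⟩ (perturb_zero p c)
    ⟨fun x => ?_, fun i j => ?_⟩).continuousAt
  · simp [quasiLine_add]
  · simp
  · have h1 : ContDiff ℝ ∞ fun q : ℝ × ℝ => (q.1 : ℂ) :=
      Complex.ofRealCLM.contDiff.comp contDiff_fst
    exact (p.smooth.comp contDiff_snd).add (h1.smul ((contDiff_quasiLine p.M c).comp contDiff_snd))
  · have h1 : HasDerivAt (fun s : ℝ => (s : ℂ)) 1 0 := Complex.ofRealCLM.hasDerivAt
    have h2 := (h1.smul_const (quasiLine p.M c x)).const_add (p.w x)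
    rw [one_smul] at h2
    exact h2
  · exact hasDerivAt_const (0 : ℝ) ((p.M : Mat2) i j)

/-! ### Points in general position -/

/-- `w` takes three pairwise linearly independent values near `c`. -/
def InGeneralPosition (p : WaveSpace) (c : ℝ) : Prop :=
  ∀ x ∈ ({c - 1 / 2, c, c + 1 / 2} : Set ℝ), ∀ y ∈ ({c - 1 / 2, c, c + 1 / 2} : Set ℝ), x ≠ y →
    p.w x 0 * p.w y 1 - p.w x 1 * p.w y 0 ≠ 0

/-- A nonzero polynomial has finitely many roots, so small nonzero real parameters avoid them. -/
theorem eventually_quadratic_ne_zero (α β : ℂ) {δ : ℂ} (hδ : δ ≠ 0) :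
    ∀ᶠ s : ℝ in 𝓝[≠] 0, α + β * s + δ * s ^ 2 ≠ 0 := by
  let P : Polynomial ℂ := Polynomial.C α + Polynomial.C β * Polynomial.X +
    Polynomial.C δ * Polynomial.X ^ 2
  have hP : P ≠ 0 := fun h => hδ <| by
    simpa [P, Polynomial.coeff_X, Polynomial.coeff_C] using congrArg (fun Q => Q.coeff 2) h
  have hfin : ((fun s : ℝ => (s : ℂ)) ⁻¹' {z | P.IsRoot z}).Finite :=
    (Polynomial.finite_setOfPred_isRoot hP).preimage Complex.ofReal_injective.injOn
  filter_upwards [nhdsNE_le_cofinite _ hfin.eventually_cofinite_notMem] with s hs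
  simpa [P] using hs

/-- The perturbation is s(1, x - c) near c, so the determinant of the values at x and y is a
quadratic polynomial in s with leading coefficient y - x ≠ 0. -/
theorem eventually_inGeneralPosition (p : WaveSpace) (c : ℝ) :
    ∀ᶠ s in 𝓝[≠] (0 : ℝ), InGeneralPosition (perturb p c s) c := by
  have hS : ({c - 1 / 2, c, c + 1 / 2} : Set ℝ).Finite := by simp
  have hnear : ∀ x ∈ ({c - 1 / 2, c, c + 1 / 2} : Set ℝ), |x - c| ≤ 1 / 2 := by
    rintro x (rfl | rfl | rfl) <;> norm_num [abs_le]
  refine (eventually_all_finite hS).2 fun x hx => (eventually_all_finite hS).2 fun y hy => ?_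
  by_cases hxy : x = y
  · exact Eventually.of_forall fun s h => absurd hxy h
  have hδ : ((y - x : ℝ) : ℂ) ≠ 0 := by
    exact_mod_cast sub_ne_zero.2 (Ne.symm hxy)
  filter_upwards [eventually_quadratic_ne_zero (p.w x 0 * p.w y 1 - p.w x 1 * p.w y 0)
    (p.w x 0 * (y - c) + p.w y 1 - p.w x 1 - p.w y 0 * (x - c)) hδ] with s hs _
  convert hs using 1
  simp only [perturb, Pi.add_apply, Pi.smul_apply, quasiLine_near p.M c (hnear x hx),
    quasiLine_near p.M c (hnear y hy), smul_eq_mul, Matrix.cons_val_zero, Matrix.cons_val_one]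
  push_cast
  ring

/-- Two observables which agree at all points in general position agree everywhere. -/
theorem eq_of_eq_inGeneralPosition {F H : WaveSpace → ℂ}
    (hF : ∀ p, ∃ D : tangentSpace p →ₗ[ℂ] ℂ, HasDifferentialAt F p D)
    (hH : ∀ p, ∃ D : tangentSpace p →ₗ[ℂ] ℂ, HasDifferentialAt H p D) (c : ℝ)
    (h : ∀ p, InGeneralPosition p c → F p = H p) (p : WaveSpace) : F p = H p := by
  obtain ⟨D, hD⟩ := hF p
  obtain ⟨D', hD'⟩ := hH p
  have h1 := (continuousAt_perturb hD c).tendsto.mono_left (nhdsWithin_le_nhds (s := {0}ᶜ))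
  have h2 := (continuousAt_perturb hD' c).tendsto.mono_left (nhdsWithin_le_nhds (s := {0}ᶜ))
  have h3 := tendsto_nhds_unique_of_eventuallyEq h1 h2
    ((eventually_inGeneralPosition p c).mono fun s hs => h _ hs)
  simpa [perturb_zero] using h3

/-- A traceless matrix with three pairwise independent eigenvectors is zero. -/
theorem eq_zero_of_three_eigenvectors {K : Mat2} (hK : K.trace = 0) {u v w : Fin 2 → ℂ}
    (huv : u 0 * v 1 - u 1 * v 0 ≠ 0) (huw : u 0 * w 1 - u 1 * w 0 ≠ 0)
    (hvw : v 0 * w 1 - v 1 * w 0 ≠ 0)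
    (hu : u 1 * (u ᵥ* K) 0 = u 0 * (u ᵥ* K) 1) (hv : v 1 * (v ᵥ* K) 0 = v 0 * (v ᵥ* K) 1)
    (hw : w 1 * (w ᵥ* K) 0 = w 0 * (w ᵥ* K) 1) : K = 0 := by
  simp only [Matrix.vecMul, dotProduct, Fin.sum_univ_two] at hu hv hw
  rw [Matrix.trace_fin_two] at hK
  -- The eigenvector condition on u is the vanishing of the binary quadratic form -K₀₁u₀² + (K₀₀ -
  -- K₁₁)u₀u₁ + K₁₀u₁². A form with three zeros on the projective line is zero; `hV` is the
  -- Vandermonde determinant, and the combinations below are Cramer's rule.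
  have hV := mul_ne_zero (mul_ne_zero huv huw) hvw
  have hA : K 0 1 = 0 := by
    refine (mul_eq_zero.1 ?_).resolve_left hV
    linear_combination -(v 1 * w 1 * (v 0 * w 1 - v 1 * w 0)) * hu +
      u 1 * w 1 * (u 0 * w 1 - u 1 * w 0) * hv - u 1 * v 1 * (u 0 * v 1 - u 1 * v 0) * hw
  have hC : K 1 0 = 0 := by
    refine (mul_eq_zero.1 ?_).resolve_left hV
    linear_combination (v 0 * w 0 * (v 0 * w 1 - v 1 * w 0)) * hu -
      u 0 * w 0 * (u 0 * w 1 - u 1 * w 0) * hv + u 0 * v 0 * (u 0 * v 1 - u 1 * v 0) * hw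
  have hB : K 0 0 - K 1 1 = 0 := by
    refine (mul_eq_zero.1 ?_).resolve_left hV
    linear_combination -((v 0 * w 1 + v 1 * w 0) * (v 0 * w 1 - v 1 * w 0)) * hu +
      (u 0 * w 1 + u 1 * w 0) * (u 0 * w 1 - u 1 * w 0) * hv -
      (u 0 * v 1 + u 1 * v 0) * (u 0 * v 1 - u 1 * v 0) * hw
  ext i j
  fin_cases i <;> fin_cases j <;> simp only [Fin.zero_eta, Fin.mk_one, Matrix.zero_apply]
  · linear_combination (hK + hB) / 2
  · exact hA
  · exact hC
  · linear_combination (hK - hB) / 2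

theorem vecMul_eq_zero_of_two {K : Mat2} {u v : Fin 2 → ℂ} (huv : u 0 * v 1 - u 1 * v 0 ≠ 0)
    (hu : u ᵥ* K = 0) (hv : v ᵥ* K = 0) : K = 0 := by
  have hu' := congrFun hu
  have hv' := congrFun hv
  simp only [Matrix.vecMul, dotProduct, Fin.sum_univ_two, Pi.zero_apply] at hu' hv'
  ext i j
  refine (mul_eq_zero.1 ?_).resolve_left huv
  fin_cases i
  · simp only [Fin.zero_eta]
    linear_combination v 1 * hu' j - u 1 * hv' j
  · simp only [Fin.mk_one]
    linear_combination u 0 * hv' j - v 0 * hu' j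

/-! ### Algebra of the exchange matrices -/

/-- The contraction of an exchange matrix with two row vectors. -/
def contract (φ γ : Fin 2 → ℂ) (X : Mat4) (k l : Fin 2) : ℂ := ∑ i, ∑ j, φ i * γ j * X (i, j) (k, l)

/-- Since c = ½ - t, one has -c + r = r₊ - ½ and c + r = r₋ + ½; the two halves add up to the last
term. -/
theorem contract_shift (φ γ : Fin 2 → ℂ) (M : Mat2) (k l : Fin 2) :
    contract φ (γ ᵥ* M) ((-1 : ℂ) • cMat + rMat) k l -
        ∑ m, contract φ γ ((1 : ℂ) • cMat + rMat) k m * M m l =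
      ∑ m, γ m * rowLeg₁ φ (leg₂ M * rPlus - rMinus * leg₂ M) k m l - φ k * (γ ᵥ* M) l := by
  fin_cases k <;> fin_cases l <;>
  simp [contract, rowLeg₁, leg₂, rPlus, rMinus, rMat, tMat, eMat, fMat, hMat, cMat,
    Matrix.mul_apply, Fintype.sum_prod_type, Matrix.one_apply, Matrix.vecMul, dotProduct] <;>
  ring

-- Expanding M₁(M₂r₊ - r₋M₂) - (M₂r₊ - r₋M₂)M₁ gives the dual bracket up to M₁M₂t - tM₁M₂, which is
-- zero because t is the flip minus ½.
set_option maxHeartbeats 2000000 in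
theorem commutator_rowLeg (M : Mat2) (i k j l : Fin 2) :
    (M * (Matrix.of fun i k => (leg₂ M * rPlus - rMinus * leg₂ M) (i, j) (k, l)) -
      (Matrix.of fun i k => (leg₂ M * rPlus - rMinus * leg₂ M) (i, j) (k, l)) * M) i k =
    dualTensor M (i, j) (k, l) := by
  fin_cases i <;> fin_cases k <;> fin_cases j <;> fin_cases l <;>
  simp [dualTensor, leg₁, leg₂, rPlus, rMinus, rMat, tMat, eMat, fMat, hMat,
    Matrix.mul_apply, Fintype.sum_prod_type, Matrix.one_apply] <;>
  ring

/-! ### Brackets of smeared evaluations with the monodromy -/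

/-- The smeared evaluation functional as an observable. -/
abbrev smearedObs {𝒜 : Subalgebra ℂ (WaveSpace → ℂ)} (h𝒜 : IsObservableAlgebra 𝒜) (f : Test)
    (k : Fin 2) : 𝒜 :=
  ⟨smeared f k, h𝒜.smeared_mem f k⟩

theorem integral_mul_rowLeg₁ (f : Test) (p : WaveSpace) (X : Mat4) (k j l : Fin 2) :
    ∫ x, f x * rowLeg₁ (p.w x) X k j l = rowLeg₁ (fun i => smeared f i p) X k j l := by
  simp only [rowLeg₁, smeared, Fin.sum_univ_two]
  rw [← MeasureTheory.integral_mul_const, ← MeasureTheory.integral_mul_const,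
    ← MeasureTheory.integral_add ((integrable_test_mul f (continuous_coord p 0)).mul_const _)
      ((integrable_test_mul f (continuous_coord p 1)).mul_const _)]
  congr 1
  funext x
  ring

theorem integral_mul_vecMul (f : Test) (p : WaveSpace) (K : Mat2) (l : Fin 2) :
    ∫ x, f x * (p.w x ᵥ* K) l = ∑ m, smeared f m p * K m l := by
  simp only [Matrix.vecMul, dotProduct, smeared, Fin.sum_univ_two]
  rw [← MeasureTheory.integral_mul_const, ← MeasureTheory.integral_mul_const,
    ← MeasureTheory.integral_add ((integrable_test_mul f (continuous_coord p 0)).mul_const _)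
      ((integrable_test_mul f (continuous_coord p 1)).mul_const _)]
  congr 1
  funext x
  ring

/-- The local part of the exchange relations, when `x - y` has a fixed sign. -/
theorem integral_exchange (f g : Test) (p : WaveSpace) (ε : ℂ) (k l : Fin 2)
    (h : ∀ x ∈ tsupport f, ∀ y ∈ tsupport g, ((Real.sign (x - y) : ℝ) : ℂ) = ε) :
    ∫ x, ∫ y, f x * g y * ∑ i, ∑ j, p.w x i * p.w y j *
        (((Real.sign (x - y) : ℝ) : ℂ) • cMat + rMat) (i, j) (k, l) =
      contract (fun i => smeared f i p) (fun j => smeared g j p) (ε • cMat + rMat) k l := by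
  have hy : ∀ x, (∫ y, f x * g y * ∑ i, ∑ j, p.w x i * p.w y j *
        (((Real.sign (x - y) : ℝ) : ℂ) • cMat + rMat) (i, j) (k, l)) =
      f x * (p.w x ᵥ* Matrix.of fun i _ : Fin 2 => ∑ j, smeared g j p *
        (ε • cMat + rMat) (i, j) (k, l)) 0 := fun x => by
    have h1 : ∀ i, (∑ j, smeared g j p * (ε • cMat + rMat) (i, j) (k, l)) =
        ∫ y, g y * (p.w y ᵥ* Matrix.of fun j _ : Fin 2 => (ε • cMat + rMat) (i, j) (k, l)) 0 :=
      fun i => (integral_mul_vecMul g p (Matrix.of fun j _ => (ε • cMat + rMat) (i, j) (k, l)) 0).symm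
    have h2 : ∀ i, MeasureTheory.Integrable fun y =>
        g y * (p.w y ᵥ* Matrix.of fun j _ : Fin 2 => (ε • cMat + rMat) (i, j) (k, l)) 0 := fun i =>
      integrable_test_mul g <| by
        simp only [Matrix.vecMul, dotProduct, Fin.sum_univ_two]
        exact ((continuous_coord p 0).mul_const _).add ((continuous_coord p 1).mul_const _)
    simp only [Matrix.vecMul, dotProduct, Matrix.of_apply, Fin.sum_univ_two (f := fun i => _ * _)]
      at h1 h2 ⊢
    rw [h1, h1, ← MeasureTheory.integral_const_mul, ← MeasureTheory.integral_const_mul,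
      ← MeasureTheory.integral_add ((h2 0).const_mul _) ((h2 1).const_mul _),
      ← MeasureTheory.integral_const_mul]
    congr 1
    funext y
    by_cases hx : x ∈ tsupport f
    · by_cases hy : y ∈ tsupport g
      · rw [h x hx y hy]
        simp only [Fin.sum_univ_two]
        ring
      · simp [image_eq_zero_of_notMem_tsupport hy]
    · simp [image_eq_zero_of_notMem_tsupport hx]
  simp only [hy]
  rw [integral_mul_vecMul]
  simp only [contract, Matrix.of_apply, Fin.sum_univ_two]
  ring

variable {𝒜 : Subalgebra ℂ (WaveSpace → ℂ)} (h𝒜 : IsObservableAlgebra 𝒜) (B : PoissonBracket 𝒜)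

theorem PoissonBracket.bracket_one (F : 𝒜) : B.bracket F 1 = 0 := by
  have h := B.leibniz F 1 1
  simpa using h

theorem PoissonBracket.bracket_mul_apply (F H K : 𝒜) (p : WaveSpace) :
    (B.bracket F (H * K)).1 p = (B.bracket F H).1 p * K.1 p + H.1 p * (B.bracket F K).1 p := by
  rw [B.leibniz]
  rfl

/-- This is w(y + 2π) = w(y)M, smeared. It lets the Leibniz rule extract brackets with M from
brackets of evaluations. -/
theorem smearedObs_shiftTest (g : Test) (l : Fin 2) :
    smearedObs h𝒜 (shiftTest g) l = smearedObs h𝒜 g 0 * monodromyObs h𝒜 (0, l) +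
      smearedObs h𝒜 g 1 * monodromyObs h𝒜 (1, l) := by
  refine Subtype.ext (funext fun p => ?_)
  have h := smeared_shiftTest g l p
  rw [Fin.sum_univ_two] at h
  exact h

/-- The values `{F, M_{jl}}` at `p`. -/
def bracketMonodromy (F : 𝒜) (p : WaveSpace) : Mat2 :=
  Matrix.of fun j l => (B.bracket F (monodromyObs h𝒜 (j, l))).1 p

theorem bracket_smearedObs_shiftTest (F : 𝒜) (g : Test) (l : Fin 2) (p : WaveSpace) :
    (B.bracket F (smearedObs h𝒜 (shiftTest g) l)).1 p =
      ∑ m, (B.bracket F (smearedObs h𝒜 g m)).1 p * (p.M : Mat2) m l +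
        ∑ m, smeared g m p * bracketMonodromy h𝒜 B F p m l := by
  rw [smearedObs_shiftTest, map_add]
  change (B.bracket F _).1 p + (B.bracket F _).1 p = _
  rw [B.bracket_mul_apply, B.bracket_mul_apply]
  simp only [Fin.sum_univ_two, bracketMonodromy, Matrix.of_apply, monodromyObs, monodromyCoeff]
  ring

/-- The trace is {F, det M}, and det M is the constant 1. -/
theorem trace_bracketMonodromy (F : 𝒜) (p : WaveSpace) :
    (bracketMonodromy h𝒜 B F p * ((p.M⁻¹ : SL2) : Mat2)).trace = 0 := by
  have h1 : monodromyObs h𝒜 (0, 0) * monodromyObs h𝒜 (1, 1) -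
      monodromyObs h𝒜 (0, 1) * monodromyObs h𝒜 (1, 0) = 1 := by
    refine Subtype.ext (funext fun q => ?_)
    have := q.M.det_coe
    rw [Matrix.det_fin_two] at this
    exact this
  have h2 := congrArg (fun H : 𝒜 => H.1 p) (B.bracket_one F)
  rw [← h1, map_sub] at h2
  change (B.bracket F _).1 p - (B.bracket F _).1 p = 0 at h2
  rw [B.bracket_mul_apply, B.bracket_mul_apply] at h2
  simp only [monodromyObs, monodromyCoeff] at h2
  simp only [Matrix.trace_fin_two, Matrix.mul_apply, Fin.sum_univ_two, bracketMonodromy,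
    monodromyObs, Matrix.of_apply, Matrix.SpecialLinearGroup.coe_inv, Matrix.adjugate_fin_two,
    Matrix.cons_val_zero, Matrix.cons_val_one, Matrix.cons_val', Matrix.cons_val_fin_one]
  linear_combination h2

/-- The matrix `u₁ (M₂ r₊ - r₋ M₂)_k` for a row vector `u`. -/
def exchangeTarget (u : Fin 2 → ℂ) (M : Mat2) (k : Fin 2) : Mat2 :=
  Matrix.of fun j l => rowLeg₁ u (leg₂ M * rPlus - rMinus * leg₂ M) k j l

/-- In the second factor the matrix is the trace of M₂r₊M₂⁻¹ - r₋, and the second legs of r_± are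
traceless. -/
theorem trace_exchangeTarget (u : Fin 2 → ℂ) (M : SL2) (k : Fin 2) :
    (exchangeTarget u M k * ((M⁻¹ : SL2) : Mat2)).trace = 0 := by
  have hd := M.det_coe
  rw [Matrix.det_fin_two] at hd
  fin_cases k <;>
  simp [exchangeTarget, rowLeg₁, leg₂, rPlus, rMinus, rMat, tMat, eMat, fMat, hMat,
    Matrix.mul_apply, Fintype.sum_prod_type, Matrix.one_apply, Matrix.trace_fin_two,
    Matrix.adjugate_fin_two] <;>
  ring

theorem sum_correlation_mul (p : WaveSpace) (f g : Test) (hfg : InWindow f g) (k l : Fin 2)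
    (z : ℝ) :
    ∑ m, correlation p f g hfg k m z * (p.M : Mat2) m l =
      ∫ y, (f (y + z) * p.w (y + z) k) * (g y * p.w (y + 2 * Real.pi) l) := by
  have hc : ∀ m z, correlation p f g hfg k m z =
      ∫ y, (f (y + z) * p.w (y + z) k) * (g y * p.w y m) := fun m z => rfl
  have hi : ∀ m, MeasureTheory.Integrable fun y =>
      (f (y + z) * p.w (y + z) k) * (g y * p.w y m) * (p.M : Mat2) m l := fun m => by
    refine (MeasureTheory.Integrable.mul_const ?_ _)
    refine (integrable_test_mul g (u := fun y => f (y + z) * p.w (y + z) k * p.w y m) ?_).congr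
      (Eventually.of_forall fun y => by ring)
    exact ((f.continuous.comp (continuous_add_const z)).mul
      ((continuous_coord p k).comp (continuous_add_const z))).mul (continuous_coord p m)
  simp only [hc, Fin.sum_univ_two]
  rw [← MeasureTheory.integral_mul_const, ← MeasureTheory.integral_mul_const,
    ← MeasureTheory.integral_add (hi 0) (hi 1)]
  congr 1
  funext y
  simp only [p.quasiPeriodic, Matrix.vecMul, dotProduct, Fin.sum_univ_two]
  ring

/-- Consequence of the exchange relations between `f` and the translates `g`, `g (· - 2π)`. -/
theorem sum_smeared_bracketMonodromy {a : 𝓓(window, ℂ) →L[ℂ] ℂ} (hB : B.HasExchangeRelations h𝒜 a)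
    (f g : Test) (k l : Fin 2) (p : WaveSpace) (h₁ : InWindow f g) (h₂ : InWindow f (shiftTest g))
    (h : ∀ x ∈ tsupport f, ∀ y ∈ tsupport g, 0 < x - y ∧ x - y < 2 * Real.pi) :
    ∑ m, smeared g m p * (bracketMonodromy h𝒜 B (smearedObs h𝒜 f k) p -
        exchangeTarget (fun i => smeared f i p) p.M k) m l =
      a (correlation p f (shiftTest g) h₂ k l) -
        a (∑ m, (p.M : Mat2) m l • correlation p f g h₁ k m) -
        smeared f k p * smeared (shiftTest g) l p := by
  have e1 := bracket_smearedObs_shiftTest h𝒜 B (smearedObs h𝒜 f k) g l p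
  have e2 := hB f (shiftTest g) h₂ k l p
  have e3 := fun m => hB f g h₁ k m p
  rw [integral_exchange f (shiftTest g) p (-1)] at e2
  swap
  -- After the shift, x - y lies in (-2π, 0), so the sign is -1.
  · intro x hx y hy
    rw [Real.sign_of_neg]
    · simp
    · linarith [(h x hx _ (tsupport_shiftTest g hy)).2]
  simp only [fun m => integral_exchange f g p 1 k m fun x hx y hy => by
    rw [Real.sign_of_pos (h x hx y hy).1, Complex.ofReal_one]] at e3
  have e4 := contract_shift (fun i => smeared f i p) (fun j => smeared g j p) p.M k l
  have e5 : ((fun j => smeared g j p) ᵥ* (p.M : Mat2)) = fun l => smeared (shiftTest g) l p := by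
    funext l
    rw [smeared_shiftTest]
    rfl
  rw [e5] at e4
  rw [e2] at e1
  simp only [e3] at e1
  simp only [map_sum, map_smul, smul_eq_mul]
  simp only [Fin.sum_univ_two, exchangeTarget, Matrix.sub_apply, Matrix.of_apply] at e1 e4 ⊢
  linear_combination -e1 + e4

/-- `w K` is parallel to `w M` for `K` the deviation of `{w_k(f), M}` from its asserted value. -/
theorem deviation_parallel {a : 𝓓(window, ℂ) →L[ℂ] ℂ} (hB : B.HasExchangeRelations h𝒜 a)
    (f : Test) (k : Fin 2) (p : WaveSpace) {U : Set ℝ} (hU : IsOpen U)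
    (h : ∀ x ∈ tsupport f, ∀ y ∈ U, 0 < x - y ∧ x - y < 2 * Real.pi) {y : ℝ} (hy : y ∈ U) :
    p.w (y + 2 * Real.pi) 1 * (p.w y ᵥ* (bracketMonodromy h𝒜 B (smearedObs h𝒜 f k) p -
        exchangeTarget (fun i => smeared f i p) p.M k)) 0 =
    p.w (y + 2 * Real.pi) 0 * (p.w y ᵥ* (bracketMonodromy h𝒜 B (smearedObs h𝒜 f k) p -
        exchangeTarget (fun i => smeared f i p) p.M k)) 1 := by
  set K := bracketMonodromy h𝒜 B (smearedObs h𝒜 f k) p -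
    exchangeTarget (fun i => smeared f i p) p.M k with hK
  have hs : ∀ i, ContDiff ℝ ∞ fun x => p.w (x + 2 * Real.pi) i := fun i =>
    (contDiff_pi.1 p.smooth i).comp (contDiff_id.add contDiff_const)
  have hcK : ∀ l, Continuous fun x => (p.w x ᵥ* K) l := fun l => by
    simp only [Matrix.vecMul, dotProduct, Fin.sum_univ_two]
    exact ((continuous_coord p 0).mul_const _).add ((continuous_coord p 1).mul_const _)
  refine sub_eq_zero.1 (eq_zero_of_integral_test_eq_zero
    (G := fun y => p.w (y + 2 * Real.pi) 1 * (p.w y ᵥ* K) 0 -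
      p.w (y + 2 * Real.pi) 0 * (p.w y ᵥ* K) 1)
    (((hs 1).continuous.mul (hcK 0)).sub ((hs 0).continuous.mul (hcK 1))) hU (fun g hg => ?_) hy)
  -- The determinant with w(y + 2π) is formed by testing component 0 with g·w₁(· + 2π) and component
  -- 1 with g·w₀(· + 2π). The unknown terms contain the product w₀w₁ at y + 2π in both cases; `c1`,
  -- `c2` and `c3` record their equality, so they cancel for any `a`.
  have hw : ∀ i, InWindow f (mulTest g _ (hs i)) := fun i x hx y hy => by
    have := h x hx y (hg (tsupport_mulTest _ _ _ hy))
    exact ⟨by linarith [Real.pi_pos], this.2⟩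
  have hw' : ∀ i, InWindow f (shiftTest (mulTest g _ (hs i))) := fun i x hx y hy => by
    have := h x hx _ (hg (tsupport_mulTest _ _ _ (tsupport_shiftTest _ hy)))
    exact ⟨by linarith, by linarith [Real.pi_pos]⟩
  have key := fun i l => sum_smeared_bracketMonodromy h𝒜 B hB f (mulTest g _ (hs i)) k l p (hw i)
    (hw' i) fun x hx y hy => h x hx y (hg (tsupport_mulTest _ _ _ hy))
  have c1 : correlation p f (shiftTest (mulTest g _ (hs 1))) (hw' 1) k 0 =
      correlation p f (shiftTest (mulTest g _ (hs 0))) (hw' 0) k 1 := by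
    ext z
    change (∫ y, (f (y + z) * p.w (y + z) k) * (shiftTest (mulTest g _ (hs 1)) y * p.w y 0)) =
      ∫ y, (f (y + z) * p.w (y + z) k) * (shiftTest (mulTest g _ (hs 0)) y * p.w y 1)
    congr 1
    funext y
    simp only [shiftTest_apply, mulTest_apply, sub_add_cancel]
    ring
  have c2 : (∑ m, (p.M : Mat2) m 0 • correlation p f (mulTest g _ (hs 1)) (hw 1) k m) =
      ∑ m, (p.M : Mat2) m 1 • correlation p f (mulTest g _ (hs 0)) (hw 0) k m := by
    ext z
    have e := fun i l => sum_correlation_mul p f (mulTest g _ (hs i)) (hw i) k l z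
    have e' : ∀ i l, (∑ m, (p.M : Mat2) m l • correlation p f (mulTest g _ (hs i)) (hw i) k m) z =
        ∑ m, correlation p f (mulTest g _ (hs i)) (hw i) k m z * (p.M : Mat2) m l := fun i l => by
      simp [Fin.sum_univ_two, mul_comm]
    rw [e', e', e, e]
    congr 1
    funext y
    simp only [mulTest_apply]
    ring
  have c3 : smeared (shiftTest (mulTest g _ (hs 1))) 0 p =
      smeared (shiftTest (mulTest g _ (hs 0))) 1 p := by
    unfold smeared
    congr 1
    funext y
    simp only [shiftTest_apply, mulTest_apply, sub_add_cancel]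
    ring
  have k1 := key 1 0
  have k2 := key 0 1
  rw [c1, c2, c3, ← k2, ← hK, ← integral_mul_vecMul, ← integral_mul_vecMul, ← sub_eq_zero,
    ← MeasureTheory.integral_sub (integrable_test_mul _ (hcK 0))
      (integrable_test_mul _ (hcK 1))] at k1
  rw [← k1]
  congr 1
  funext y
  simp only [mulTest_apply]
  ring

/-- `{w_k(f), M}` at points in general position, for test functions of small support. -/
theorem bracketMonodromy_of_inGeneralPosition {a : 𝓓(window, ℂ) →L[ℂ] ℂ}
    (hB : B.HasExchangeRelations h𝒜 a) (f : Test) (k : Fin 2) (p : WaveSpace) (c : ℝ)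
    (hf : tsupport f ⊆ Set.Ioo (c - 1) (c + 1)) (hp : InGeneralPosition p (c - Real.pi)) :
    bracketMonodromy h𝒜 B (smearedObs h𝒜 f k) p = exchangeTarget (fun i => smeared f i p) p.M k := by
  set K := bracketMonodromy h𝒜 B (smearedObs h𝒜 f k) p -
    exchangeTarget (fun i => smeared f i p) p.M k with hK
  have hpi := Real.pi_gt_three
  -- For x within 1 of c and y within 1 of c - π, the difference x - y lies in (π - 2, π + 2), hence
  -- in (0, 2π). Multiplying on the right by M⁻¹ preserves parallelism and turns wK ∥ wM into an
  -- eigenvector condition.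
  have key : ∀ y ∈ Set.Ioo (c - Real.pi - 1) (c - Real.pi + 1),
      p.w y 1 * (p.w y ᵥ* (K * ((p.M⁻¹ : SL2) : Mat2))) 0 =
        p.w y 0 * (p.w y ᵥ* (K * ((p.M⁻¹ : SL2) : Mat2))) 1 := by
    intro y hy
    have h := deviation_parallel h𝒜 B hB f k p isOpen_Ioo (fun x hx y hy => by
      have h1 := hf hx
      rw [Set.mem_Ioo] at h1 hy
      constructor <;> linarith [h1.1, h1.2, hy.1, hy.2]) hy
    rw [← hK, p.quasiPeriodic] at h
    have hd := p.M.det_coe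
    rw [Matrix.det_fin_two] at hd
    simp only [Matrix.vecMul, dotProduct, Fin.sum_univ_two, Matrix.mul_apply,
      Matrix.SpecialLinearGroup.coe_inv, Matrix.adjugate_fin_two, Matrix.of_apply,
      Matrix.cons_val_zero, Matrix.cons_val_one, Matrix.cons_val', Matrix.cons_val_fin_one] at h ⊢
    linear_combination h
  have m1 : c - Real.pi - 1 / 2 ∈ Set.Ioo (c - Real.pi - 1) (c - Real.pi + 1) := by
    constructor <;> linarith
  have m2 : c - Real.pi ∈ Set.Ioo (c - Real.pi - 1) (c - Real.pi + 1) := by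
    constructor <;> linarith
  have m3 : c - Real.pi + 1 / 2 ∈ Set.Ioo (c - Real.pi - 1) (c - Real.pi + 1) := by
    constructor <;> linarith
  have hz : K * ((p.M⁻¹ : SL2) : Mat2) = 0 :=
    eq_zero_of_three_eigenvectors
      (by rw [hK, Matrix.sub_mul, Matrix.trace_sub, trace_bracketMonodromy, trace_exchangeTarget,
        sub_zero])
      (hp _ (by simp) _ (by simp) (by linarith)) (hp _ (by simp) _ (by simp) (by linarith))
      (hp _ (by simp) _ (by simp) (by linarith)) (key _ m1) (key _ m2) (key _ m3)
  have hM : ((p.M⁻¹ : SL2) : Mat2) * (p.M : Mat2) = 1 := by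
    rw [← Matrix.SpecialLinearGroup.coe_mul, inv_mul_cancel, Matrix.SpecialLinearGroup.coe_one]
  rw [← sub_eq_zero, ← hK, ← Matrix.mul_one K, ← hM, ← Matrix.mul_assoc, hz, Matrix.zero_mul]

/-! ### The brackets with the monodromy at arbitrary points -/

/-- The first leg of the matrix `M₂ r₊ - r₋ M₂` whose second leg has indices `j`, `l`. -/
def firstLeg (M : Mat2) (j l : Fin 2) : Mat2 :=
  Matrix.of fun i k => (leg₂ M * rPlus - rMinus * leg₂ M) (i, j) (k, l)

theorem firstLeg_apply (M : Mat2) (i k j l : Fin 2) :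
    firstLeg M j l i k = ∑ m, (rPlus (i, m) (k, l) * M j m - rMinus (i, j) (k, m) * M m l) := by
  simp [firstLeg, leg₂, Matrix.mul_apply, Fintype.sum_prod_type, Matrix.one_apply, mul_comm]

theorem firstLeg_mem {𝒜 : Subalgebra ℂ (WaveSpace → ℂ)} (h𝒜 : IsObservableAlgebra 𝒜) (i k j l : Fin 2) : (fun p : WaveSpace => firstLeg p.M j l i k) ∈ 𝒜 := by
  have h : (fun p : WaveSpace => firstLeg p.M j l i k) = ∑ m,
      (rPlus (i, m) (k, l) • monodromyCoeff j m - rMinus (i, j) (k, m) • monodromyCoeff m l) := by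
    funext p
    rw [firstLeg_apply, Finset.sum_apply]
    rfl
  rw [h]
  exact 𝒜.sum_mem fun m _ => 𝒜.sub_mem (𝒜.smul_mem (h𝒜.monodromyCoeff_mem _ _) _)
    (𝒜.smul_mem (h𝒜.monodromyCoeff_mem _ _) _)

/-- Both sides are observables, the right one being polynomial in smeared evaluations and matrix
coefficients, so agreement in general position suffices. -/
theorem bracket_smeared_monodromy_of_small {a : 𝓓(window, ℂ) →L[ℂ] ℂ}
    (hB : B.HasExchangeRelations h𝒜 a) (f : Test) (k j l : Fin 2) (p : WaveSpace) (c : ℝ)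
    (hf : tsupport f ⊆ Set.Ioo (c - 1) (c + 1)) :
    (B.bracket (smearedObs h𝒜 f k) (monodromyObs h𝒜 (j, l))).1 p =
      rowLeg₁ (fun i => smeared f i p) (leg₂ p.M * rPlus - rMinus * leg₂ p.M) k j l := by
  refine eq_of_eq_inGeneralPosition
    (H := fun p => rowLeg₁ (fun i => smeared f i p) (leg₂ p.M * rPlus - rMinus * leg₂ p.M) k j l)
    (h𝒜.differentiable _ (Subtype.mem _)) (h𝒜.differentiable _ ?_) (c - Real.pi) (fun q hq => ?_) p
  · have h : (fun p : WaveSpace => rowLeg₁ (fun i => smeared f i p)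
        (leg₂ p.M * rPlus - rMinus * leg₂ p.M) k j l) =
        ∑ i, smeared f i * fun p : WaveSpace => firstLeg p.M j l i k := by
      funext p
      rw [Finset.sum_apply]
      rfl
    rw [h]
    exact 𝒜.sum_mem fun i _ => 𝒜.mul_mem (h𝒜.smeared_mem f i) (firstLeg_mem h𝒜 i k j l)
  · exact congrFun (congrFun (bracketMonodromy_of_inGeneralPosition h𝒜 B hB f k q c hf hq) j) l

/-- The two continuous functions of x have the same integrals against all test functions supported
near the given point. -/
theorem hamiltonianVector_apply {a : 𝓓(window, ℂ) →L[ℂ] ℂ} (hB : B.HasExchangeRelations h𝒜 a)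
    (j l : Fin 2) (p : WaveSpace) (X : tangentSpace p)
    (hX : B.IsHamiltonianVector (monodromyObs h𝒜 (j, l)) p X) (x : ℝ) (k : Fin 2) :
    X.1.1 x k = rowLeg₁ (p.w x) (leg₂ p.M * rPlus - rMinus * leg₂ p.M) k j l := by
  have hc : Continuous fun x => rowLeg₁ (p.w x) (leg₂ p.M * rPlus - rMinus * leg₂ p.M) k j l :=
    continuous_finsetSum _ fun i _ => (continuous_coord p i).mul_const _
  have hX1 : Continuous fun x => X.1.1 x k := (contDiff_pi.1 X.2.1 k).continuous
  have hx : x ∈ Set.Ioo (x - 1) (x + 1) := by constructor <;> linarith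
  refine sub_eq_zero.1 (eq_zero_of_integral_test_eq_zero
    (G := fun x => X.1.1 x k - rowLeg₁ (p.w x) (leg₂ p.M * rPlus - rMinus * leg₂ p.M) k j l)
    (hX1.sub hc) isOpen_Ioo (fun g hg => ?_) hx)
  have h1 := hX (smearedObs h𝒜 g k) _ (hasDifferentialAt_smeared g k p)
  rw [bracket_smeared_monodromy_of_small h𝒜 B hB g k j l p x hg, ← integral_mul_rowLeg₁] at h1
  change _ = ∫ y, g y * X.1.1 y k at h1
  simp only [mul_sub]
  rw [MeasureTheory.integral_sub (integrable_test_mul g hX1) (integrable_test_mul g hc), h1,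
    sub_self]

theorem bracket_smeared_monodromy {a : 𝓓(window, ℂ) →L[ℂ] ℂ} (hB : B.HasExchangeRelations h𝒜 a)
    (f : Test) (k j l : Fin 2) (p : WaveSpace) :
    (B.bracket (smearedObs h𝒜 f k) (monodromyObs h𝒜 (j, l))).1 p =
      ∫ x, f x * rowLeg₁ (p.w x) (leg₂ p.M * rPlus - rMinus * leg₂ p.M) k j l := by
  -- The pointwise formula holds at every x, so integrating it against f needs no bound on the
  -- support.
  obtain ⟨X, hX⟩ := B.hamiltonian (monodromyObs h𝒜 (j, l)) p
  rw [hX (smearedObs h𝒜 f k) _ (hasDifferentialAt_smeared f k p)]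
  simp only [← hamiltonianVector_apply h𝒜 B hB j l p X hX]
  rfl

/-- The Hamiltonian vector (wL, N) of M_{jl} is tangent to 𝒲, so wML = wLM + wN at every point. Two
independent values of w give N = [M, L]; other points are reached by continuity. -/
theorem bracket_monodromy {a : 𝓓(window, ℂ) →L[ℂ] ℂ} (hB : B.HasExchangeRelations h𝒜 a)
    (i k j l : Fin 2) (p : WaveSpace) :
    (B.bracket (monodromyObs h𝒜 (i, k)) (monodromyObs h𝒜 (j, l))).1 p =
      dualTensor p.M (i, j) (k, l) := by
  refine eq_of_eq_inGeneralPosition (H := fun p => dualTensor p.M (i, j) (k, l))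
    (h𝒜.differentiable _ (Subtype.mem _)) (h𝒜.differentiable _ ?_) 0 (fun q hq => ?_) p
  · have h : (fun p : WaveSpace => dualTensor p.M (i, j) (k, l)) =
        ∑ m, monodromyCoeff i m * (fun p : WaveSpace => firstLeg p.M j l m k) -
          ∑ m, (fun p : WaveSpace => firstLeg p.M j l i m) * monodromyCoeff m k := by
      funext p
      rw [← commutator_rowLeg, Pi.sub_apply, Finset.sum_apply, Finset.sum_apply]
      rfl
    rw [h]
    exact 𝒜.sub_mem
      (𝒜.sum_mem fun m _ => 𝒜.mul_mem (h𝒜.monodromyCoeff_mem _ _) (firstLeg_mem h𝒜 _ _ _ _))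
      (𝒜.sum_mem fun m _ => 𝒜.mul_mem (firstLeg_mem h𝒜 _ _ _ _) (h𝒜.monodromyCoeff_mem _ _))
  · obtain ⟨X, hX⟩ := B.hamiltonian (monodromyObs h𝒜 (j, l)) q
    have hv : ∀ x, X.1.1 x = q.w x ᵥ* firstLeg q.M j l := fun x =>
      funext fun m => hamiltonianVector_apply h𝒜 B hB j l q X hX x m
    have hz : ∀ x, q.w x ᵥ* ((q.M : Mat2) * firstLeg q.M j l - firstLeg q.M j l * (q.M : Mat2) -
        X.1.2) = 0 := fun x => by
      have h := X.2.2.1 x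
      rw [hv, hv, q.quasiPeriodic, Matrix.vecMul_vecMul, Matrix.vecMul_vecMul] at h
      rw [Matrix.vecMul_sub, Matrix.vecMul_sub, h]
      abel
    have h0 := vecMul_eq_zero_of_two (hq (0 - 1 / 2) (by simp) 0 (by simp) (by norm_num)) (hz _)
      (hz _)
    rw [hX _ _ (hasDifferentialAt_monodromyCoeff i k q), ← commutator_rowLeg]
    exact (congrFun (congrFun (sub_eq_zero.1 h0) i) k).symm

/-- The monodromy component of the Hamiltonian vector field of `M_{jl}`. -/
theorem hamiltonianVector_snd {a : 𝓓(window, ℂ) →L[ℂ] ℂ} (hB : B.HasExchangeRelations h𝒜 a)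
    (j l : Fin 2) (p : WaveSpace) (X : tangentSpace p)
    (hX : B.IsHamiltonianVector (monodromyObs h𝒜 (j, l)) p X) :
    X.1.2 = (p.M : Mat2) * firstLeg p.M j l - firstLeg p.M j l * (p.M : Mat2) := by
  ext i k
  have h := hX (monodromyObs h𝒜 (i, k)) _ (hasDifferentialAt_monodromyCoeff i k p)
  rw [bracket_monodromy h𝒜 B hB, ← commutator_rowLeg] at h
  exact h.symm

/-! ### The Poisson map to the dual group -/

/-- A derivation of a polynomial expression is determined by its values on the generators. -/
theorem bracket_aeval (F : 𝒜) (P : MvPolynomial Entry ℂ) (p : WaveSpace) :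
    (B.bracket F (pullback h𝒜 P)).1 p =
      ∑ n, MvPolynomial.eval (fun m => (p.M : Mat2) m.1 m.2) (MvPolynomial.pderiv n P) *
        (B.bracket F (monodromyObs h𝒜 n)).1 p := by
  have hev : ∀ P, (pullback h𝒜 P).1 p = MvPolynomial.eval (fun m => (p.M : Mat2) m.1 m.2) P := by
    intro P
    induction P using MvPolynomial.induction_on with
    | C c => simp [pullback]
    | add P Q hP hQ =>
      rw [map_add, ← hP, ← hQ, pullback, map_add]
      rfl
    | mul_X P n hP =>
      rw [map_mul, ← hP, pullback, map_mul, MvPolynomial.eval_X, MvPolynomial.aeval_X]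
      rfl
  induction P using MvPolynomial.induction_on with
  | C c =>
    have h : pullback h𝒜 (MvPolynomial.C c) = c • (1 : 𝒜) := by
      rw [pullback, MvPolynomial.aeval_C, Algebra.algebraMap_eq_smul_one]
    rw [h, map_smul, B.bracket_one]
    simp
  | add P Q hP hQ =>
    have h : pullback h𝒜 (P + Q) = pullback h𝒜 P + pullback h𝒜 Q := map_add _ _ _
    rw [h, map_add]
    change (B.bracket F _).1 p + (B.bracket F _).1 p = _
    rw [hP, hQ, ← Finset.sum_add_distrib]
    simp only [map_add, add_mul]
  | mul_X P n hP =>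
    have h : pullback h𝒜 (P * MvPolynomial.X n) = pullback h𝒜 P * monodromyObs h𝒜 n := by
      rw [pullback, map_mul, MvPolynomial.aeval_X]
      rfl
    rw [h, B.bracket_mul_apply, hP, hev]
    have hd : ∀ m, MvPolynomial.eval (fun m => (p.M : Mat2) m.1 m.2)
        (MvPolynomial.pderiv m (P * MvPolynomial.X n)) *
          (B.bracket F (monodromyObs h𝒜 m)).1 p =
        MvPolynomial.eval (fun m => (p.M : Mat2) m.1 m.2) (MvPolynomial.pderiv m P) *
          (B.bracket F (monodromyObs h𝒜 m)).1 p * (p.M : Mat2) n.1 n.2 +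
        if n = m then MvPolynomial.eval (fun m => (p.M : Mat2) m.1 m.2) P *
          (B.bracket F (monodromyObs h𝒜 m)).1 p else 0 := fun m => by
      rw [Derivation.leibniz, MvPolynomial.pderiv_X, Pi.single_apply]
      split_ifs <;> simp only [smul_eq_mul, map_add, map_mul, MvPolynomial.eval_X, map_one,
        map_zero] <;> ring
    simp only [hd]
    rw [Finset.sum_add_distrib, ← Finset.sum_mul, Finset.sum_ite_eq, if_pos (Finset.mem_univ n)]
    rfl

theorem bracket_pullback {a : 𝓓(window, ℂ) →L[ℂ] ℂ} (hB : B.HasExchangeRelations h𝒜 a)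
    (P Q : MvPolynomial Entry ℂ) (p : WaveSpace) :
    (B.bracket (pullback h𝒜 P) (pullback h𝒜 Q)).1 p =
      biderivation (entries (dualTensor p.M)) (fun m => (p.M : Mat2) m.1 m.2) P Q := by
  have hs : ∀ F H : 𝒜, (B.bracket F H).1 p = -(B.bracket H F).1 p := fun F H => by
    rw [B.skew]
    rfl
  have h1 : ∀ n, (B.bracket (pullback h𝒜 P) (monodromyObs h𝒜 n)).1 p =
      ∑ m, MvPolynomial.eval (fun m => (p.M : Mat2) m.1 m.2) (MvPolynomial.pderiv m P) *
        dualTensor p.M (m.1, n.1) (m.2, n.2) := fun n => by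
    rw [hs, bracket_aeval, ← Finset.sum_neg_distrib]
    refine Finset.sum_congr rfl fun m _ => ?_
    rw [hs, mul_neg, neg_neg, bracket_monodromy h𝒜 B hB m.1 m.2 n.1 n.2]
  rw [bracket_aeval, biderivation, Finset.sum_comm]
  refine Finset.sum_congr rfl fun n _ => ?_
  rw [h1, Finset.mul_sum]
  refine Finset.sum_congr rfl fun m _ => ?_
  simp only [entries]
  ring

theorem pderiv_bind₁ {σ τ : Type} [Fintype σ] [DecidableEq σ] (φ : σ → MvPolynomial τ ℂ)
    (P : MvPolynomial σ ℂ) (m : τ) :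
    MvPolynomial.pderiv m (MvPolynomial.bind₁ φ P) =
      ∑ n, MvPolynomial.bind₁ φ (MvPolynomial.pderiv n P) * MvPolynomial.pderiv m (φ n) := by
  induction P using MvPolynomial.induction_on with
  | C c => simp
  | add P Q hP hQ => simp only [map_add, hP, hQ, add_mul, Finset.sum_add_distrib]
  | mul_X P n hP =>
    simp only [map_mul, MvPolynomial.bind₁_X_right, Derivation.leibniz, hP, MvPolynomial.pderiv_X,
      smul_eq_mul, map_add, add_mul, Finset.sum_add_distrib]
    congr 1
    · rw [Finset.sum_eq_single n (by intro m _ hm; simp [hm.symm]) (by simp)]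
      simp
    · rw [Finset.mul_sum]
      exact Finset.sum_congr rfl fun m _ => by ring

/-- Chain rule for biderivations. -/
theorem biderivation_bind₁ {σ τ : Type} [Fintype σ] [DecidableEq σ] [Fintype τ]
    (π : τ → τ → ℂ) (x : τ → ℂ) (φ : σ → MvPolynomial τ ℂ) (P Q : MvPolynomial σ ℂ) :
    biderivation π x (MvPolynomial.bind₁ φ P) (MvPolynomial.bind₁ φ Q) =
      biderivation (fun i j => biderivation π x (φ i) (φ j))
        (fun i => MvPolynomial.eval x (φ i)) P Q := by
  have he : ∀ R, MvPolynomial.eval x (MvPolynomial.bind₁ φ R) =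
      MvPolynomial.eval (fun i => MvPolynomial.eval x (φ i)) R := fun R => by
    simp only [MvPolynomial.eval, MvPolynomial.eval₂Hom_bind₁]
  have hs : ∀ (ι : Type) [Fintype ι] (f : τ → τ → ι → ℂ),
      ∑ m, ∑ n, ∑ i, f m n i = ∑ i, ∑ m, ∑ n, f m n i := fun ι _ f => by
    exact (Finset.sum_congr rfl fun m _ => Finset.sum_comm).trans Finset.sum_comm
  have ht : ∀ m n, MvPolynomial.eval x (MvPolynomial.pderiv m (MvPolynomial.bind₁ φ P)) *
      MvPolynomial.eval x (MvPolynomial.pderiv n (MvPolynomial.bind₁ φ Q)) * π m n =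
      ∑ i, ∑ j, MvPolynomial.eval (fun i => MvPolynomial.eval x (φ i)) (MvPolynomial.pderiv i P) *
        MvPolynomial.eval (fun i => MvPolynomial.eval x (φ i)) (MvPolynomial.pderiv j Q) *
        (MvPolynomial.eval x (MvPolynomial.pderiv m (φ i)) *
          MvPolynomial.eval x (MvPolynomial.pderiv n (φ j)) * π m n) := fun m n => by
    simp only [pderiv_bind₁, map_sum, map_mul, he]
    rw [Finset.sum_mul_sum, Finset.sum_mul]
    refine Finset.sum_congr rfl fun i _ => ?_
    rw [Finset.sum_mul]
    exact Finset.sum_congr rfl fun j _ => by ring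
  simp only [biderivation, ht]
  rw [hs]
  refine Finset.sum_congr rfl fun i _ => ?_
  rw [hs]
  refine Finset.sum_congr rfl fun j _ => ?_
  simp only [Finset.mul_sum]

theorem eval_factorPoly (b : dualGroup) (n : Entry) :
    MvPolynomial.eval (dualCoord b) (factorPoly n) = (factorMap b : Mat2) n.1 n.2 := by
  obtain ⟨i, j⟩ := n
  fin_cases j <;>
  simp [factorPoly, factorMap, Matrix.adjugate_fin_two, Matrix.mul_apply, dualCoord]

/-- The gradient of `factorPoly (i, j)` at the point with coordinates `b₊`, `b₋`. -/
def factorGrad (bp bm : Mat2) (i j : Fin 2) : Entry ⊕ Entry → ℂ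
  | .inl m => if m.1 = i then bm.adjugate m.2 j else 0
  -- The adjugate of a 2 × 2 matrix is linear in its entries, so its derivative along a matrix unit
  -- is the adjugate of that unit.
  | .inr m => bp i 0 * (Matrix.adjugate (Matrix.single m.1 m.2 (1 : ℂ))) 0 j +
      bp i 1 * (Matrix.adjugate (Matrix.single m.1 m.2 (1 : ℂ))) 1 j

theorem eval_pderiv_factorPoly (b : dualGroup) (i j : Fin 2) (m : Entry ⊕ Entry) :
    MvPolynomial.eval (dualCoord b) (MvPolynomial.pderiv m (factorPoly (i, j))) =
      factorGrad b.1.1 b.1.2 i j m := by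
  rcases m with ⟨m, n⟩ | ⟨m, n⟩ <;>
  fin_cases i <;> fin_cases j <;> fin_cases m <;> fin_cases n <;>
  simp [factorPoly, Matrix.adjugate_fin_two, Matrix.mul_apply, dualCoord, factorGrad,
    MvPolynomial.pderiv_X]

/-- r has only two nonzero entries; this sparse form keeps the sixteen coordinate checks on G*
small. -/
theorem comm_rMat_apply (X : Mat4) (i j k l : Fin 2) :
    comm rMat X (i, j) (k, l) =
      ((if i = 0 ∧ j = 1 then X (1, 0) (k, l) else 0) -
        if i = 1 ∧ j = 0 then X (0, 1) (k, l) else 0) -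
      ((if k = 1 ∧ l = 0 then X (i, j) (0, 1) else 0) -
        if k = 0 ∧ l = 1 then X (i, j) (1, 0) else 0) := by
  simp only [comm, rMat, eMat, fMat, Matrix.sub_apply, Matrix.mul_apply, Fintype.sum_prod_type,
    Fin.sum_univ_two, Matrix.kroneckerMap_apply]
  congr 1
  · fin_cases i <;> fin_cases j <;> simp
  · fin_cases k <;> fin_cases l <;> simp

/-- Here r₊ = ½ h ⊗ h + 2 e ⊗ f: a diagonal part and a single off-diagonal entry. -/
theorem comm_rPlus_apply (X : Mat4) (i j k l : Fin 2) :
    comm rPlus X (i, j) (k, l) =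
      ((if i = j then 1 / 2 else -1 / 2) * X (i, j) (k, l) +
        if i = 0 ∧ j = 1 then 2 * X (1, 0) (k, l) else 0) -
      ((if k = l then 1 / 2 else -1 / 2) * X (i, j) (k, l) +
        if k = 1 ∧ l = 0 then 2 * X (i, j) (0, 1) else 0) := by
  simp only [comm, rPlus, rMat, tMat, eMat, fMat, hMat, Matrix.sub_apply, Matrix.mul_apply,
    Fintype.sum_prod_type, Fin.sum_univ_two, Matrix.kroneckerMap_apply, Matrix.add_apply,
    Matrix.smul_apply]
  congr 1
  · fin_cases i <;> fin_cases j <;> simp <;> ring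
  · fin_cases k <;> fin_cases l <;> simp <;> ring

/-- The components of `b₊` and `b₋` for `(b₊, b₋) ∈ G*`. -/
theorem exists_dualGroup_coords (b : dualGroup) : ∃ α δ u v : ℂ, α * δ = 1 ∧
    (b.1.1 : Mat2) = !![α, u; 0, δ] ∧ (b.1.2 : Mat2) = !![δ, 0; v, α] := by
  obtain ⟨h1, h2, h3⟩ := b.2
  have d1 := b.1.1.det_coe
  have d2 := b.1.2.det_coe
  rw [Matrix.det_fin_two] at d1 d2
  have h30 := h3 0
  have h31 := h3 1
  refine ⟨b.1.1 0 0, b.1.1 1 1, b.1.1 0 1, b.1.2 1 0, ?_, ?_, ?_⟩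
  · rw [h1] at d1
    linear_combination d1
  · rw [← h1]
    exact Matrix.eta_fin_two _
  · have e0 : b.1.2 0 0 = b.1.1 1 1 := by
      rw [h1] at d1
      linear_combination b.1.1 1 1 * h30 - b.1.2 0 0 * d1
    have e1 : b.1.2 1 1 = b.1.1 0 0 := by
      rw [h1] at d1
      linear_combination b.1.1 0 0 * h31 - b.1.2 1 1 * d1
    rw [← h2, ← e0, ← e1]
    exact Matrix.eta_fin_two _

theorem dualTensor_apply (M : Mat2) (i j k l : Fin 2) :
    dualTensor M (i, j) (k, l) =
      ∑ m, (M i m * firstLeg M j l m k - firstLeg M j l i m * M m k) := by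
  rw [← commutator_rowLeg, Finset.sum_sub_distrib]
  rfl

/-- By the chain rule it is enough to compare brackets of the entries of b₊b₋⁻¹. In the parameters
α, δ, u, v these are polynomial identities modulo αδ = 1. -/
theorem biderivation_factorPoly (b : dualGroup) (m n : Entry) :
    biderivation (dualBivector b) (dualCoord b) (factorPoly m) (factorPoly n) =
      entries (dualTensor (factorMap b : Mat2)) m n := by
  obtain ⟨α, δ, u, v, h, hp, hm⟩ := exists_dualGroup_coords b
  obtain ⟨i, k⟩ := m
  obtain ⟨j, l⟩ := n
  have hM : (factorMap b : Mat2) = !![α * α - u * v, u * δ; -(δ * v), δ * δ] := by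
    simp [factorMap, hp, hm, Matrix.adjugate_fin_two]
    ring
  simp only [biderivation, eval_pderiv_factorPoly, Fintype.sum_sum_type, Fintype.sum_prod_type,
    Fin.sum_univ_two, dualBivector, entries, dualTensor_apply, comm_rMat_apply, comm_rPlus_apply,
    firstLeg_apply, hM, hp, hm]
  fin_cases i <;> fin_cases j <;> fin_cases k <;> fin_cases l <;>
  simp [factorGrad, Matrix.adjugate_fin_two, rPlus, rMinus, rMat, tMat, eMat,
    fMat, hMat] <;> grind

/-! ### The moment map -/

theorem trace_inverse_mul_commutator {M A : Mat2} (h : M * A = 1) (ξ : Mat2) :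
    (A * (M * ξ - ξ * M)).trace = 0 := by
  rw [Matrix.trace_mul_comm, Matrix.sub_mul, Matrix.trace_sub, Matrix.trace_mul_cycle,
    Matrix.mul_assoc ξ, h, mul_eq_one_comm.1 h, Matrix.one_mul, Matrix.mul_one, sub_self]

/-- The infinitesimal right action of `ξ` at `p`. -/
def actionVector (p : WaveSpace) : Mat2 →ₗ[ℂ] tangentSpace p where
  toFun ξ := ⟨(fun x => p.w x ᵥ* ξ, (p.M : Mat2) * ξ - ξ * (p.M : Mat2)), by
    refine ⟨?_, fun x => ?_, ?_⟩
    · have h := contDiff_pi.1 p.smooth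
      refine contDiff_pi.2 fun i => ?_
      simp only [Matrix.vecMul, dotProduct, Fin.sum_univ_two]
      exact ((h 0).mul contDiff_const).add ((h 1).mul contDiff_const)
    · simp only [p.quasiPeriodic, Matrix.vecMul_vecMul, Matrix.vecMul_sub]
      abel
    · have h : (p.M : Mat2) * ((p.M⁻¹ : SL2) : Mat2) = 1 := by
        rw [← Matrix.SpecialLinearGroup.coe_mul, mul_inv_cancel, Matrix.SpecialLinearGroup.coe_one]
      exact trace_inverse_mul_commutator h ξ⟩
  map_add' ξ η := by
    refine Subtype.ext (Prod.ext (funext fun x => Matrix.vecMul_add ξ η (p.w x)) ?_)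
    simp only [Submodule.coe_add, Prod.snd_add, Matrix.mul_add, Matrix.add_mul]
    abel
  map_smul' c ξ := by
    refine Subtype.ext (Prod.ext (funext fun x => Matrix.vecMul_smul (p.w x) c ξ) ?_)
    simp [smul_sub]

theorem hasDerivAt_mul_mul {A C : ℝ → Mat2} {A' C' : Mat2} (hA : A 0 = 1) (hC : C 0 = 1) (N : Mat2)
    {i j : Fin 2} (hA' : ∀ k, HasDerivAt (fun s => A s i k) (A' i k) 0)
    (hC' : ∀ k, HasDerivAt (fun s => C s k j) (C' k j) 0) :
    HasDerivAt (fun s => (A s * N * C s) i j) ((A' * N + N * C') i j) 0 := by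
  simp only [Matrix.mul_apply, Fin.sum_univ_two]
  refine (((((hA' 0).mul_const _).add ((hA' 1).mul_const _)).mul (hC' 0)).add
    ((((hA' 0).mul_const _).add ((hA' 1).mul_const _)).mul (hC' 1))).congr_deriv ?_
  simp only [hC, Matrix.add_apply, Matrix.mul_apply, Fin.sum_univ_two]
  clear hA' hC'
  fin_cases i <;> fin_cases j <;> simp [hA, Matrix.one_apply] <;> ring

theorem hasDerivAt_act {F : WaveSpace → ℂ} {p : WaveSpace} {D : tangentSpace p →ₗ[ℂ] ℂ}
    (hF : HasDifferentialAt F p D) {g : ℝ → SL2} {ξ : Mat2}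
    (hg : ∀ i j, ContDiff ℝ ∞ fun s => (g s : Mat2) i j) (h0 : g 0 = 1)
    (hξ : ∀ i j, HasDerivAt (fun s => (g s : Mat2) i j) (ξ i j) 0) :
    ξ.trace = 0 ∧ HasDerivAt (fun s => F (p.act (g s))) (D (actionVector p ξ)) 0 := by
  have g0 : ∀ i j, (g 0 : Mat2) i j = (1 : Mat2) i j := fun i j => by
    rw [h0, Matrix.SpecialLinearGroup.coe_one]
  -- Differentiating det g = 1 at the unit gives tr ξ = 0, which is needed both for the derivative
  -- of g⁻¹ and for the pairing with 𝔤*.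
  have htr : ξ.trace = 0 := by
    have h1 := ((hξ 0 0).mul (hξ 1 1)).sub ((hξ 0 1).mul (hξ 1 0))
    have h2 : HasDerivAt (fun s => (g s : Mat2) 0 0 * (g s : Mat2) 1 1 -
        (g s : Mat2) 0 1 * (g s : Mat2) 1 0) 0 0 := by
      have h3 : (fun s => (g s : Mat2) 0 0 * (g s : Mat2) 1 1 -
          (g s : Mat2) 0 1 * (g s : Mat2) 1 0) = fun _ => 1 := by
        funext s
        rw [← Matrix.det_fin_two, (g s).det_coe]
      rw [h3]
      exact hasDerivAt_const _ _
    have h4 := h1.unique h2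
    simp only [g0, Matrix.one_apply] at h4
    rw [Matrix.trace_fin_two]
    simpa using h4
  have hact : ∀ s i j, ((p.act (g s)).M : Mat2) i j =
      ((g s : Mat2).adjugate * (p.M : Mat2) * (g s : Mat2)) i j := fun s i j => by
    simp [WaveSpace.act]
  refine ⟨htr, hF (fun s => p.act (g s)) (actionVector p ξ) ⟨?_, fun i j => ?_⟩ ?_ ⟨fun x => ?_,
    fun i j => ?_⟩⟩
  · refine contDiff_pi.2 fun i => ?_
    simp only [WaveSpace.act, Matrix.vecMul, dotProduct, Fin.sum_univ_two]
    have h := fun k => (contDiff_pi.1 p.smooth k).comp (contDiff_snd (E := ℝ) (F := ℝ) (𝕜 := ℝ))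
    have h' := fun k => (hg k i).comp (contDiff_fst (E := ℝ) (F := ℝ) (𝕜 := ℝ))
    exact ((h 0).mul (h' 0)).add ((h 1).mul (h' 1))
  · simp only [hact, Matrix.mul_apply, Fin.sum_univ_two, Matrix.adjugate_fin_two]
    have hn := fun i j => (hg i j).neg
    fin_cases i <;> simp <;> fun_prop
  · rw [h0]
    ext <;> simp [WaveSpace.act]
  · refine hasDerivAt_pi.2 fun i => ?_
    simp only [WaveSpace.act, Matrix.vecMul, dotProduct, Fin.sum_univ_two]
    exact (((hξ 0 i).const_mul (p.w x 0)).add ((hξ 1 i).const_mul (p.w x 1))).congr_deriv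
      (by simp [actionVector, Matrix.vecMul, dotProduct])
  · have hadj : ∀ k, HasDerivAt (fun s => (g s : Mat2).adjugate i k) ((-ξ) i k) 0 := fun k => by
      rw [Matrix.trace_fin_two] at htr
      simp only [Matrix.adjugate_fin_two]
      fin_cases i <;> fin_cases k
      · exact (hξ 1 1).congr_deriv (by simp; linear_combination htr)
      · exact (hξ 0 1).neg
      · exact (hξ 1 0).neg
      · exact (hξ 0 0).congr_deriv (by simp; linear_combination htr)
    simp only [hact]
    have h1 : (g 0 : Mat2) = 1 := by rw [h0, Matrix.SpecialLinearGroup.coe_one]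
    refine (hasDerivAt_mul_mul (A := fun s => (g s : Mat2).adjugate) (C := fun s => (g s : Mat2))
      (by simp only [h1, Matrix.adjugate_one]) h1 (p.M : Mat2) hadj fun k => hξ k j).congr_deriv ?_
    simp [actionVector, sub_eq_add_neg, add_comm]

theorem apply_of_trace_eq_zero (Z : Mat2 →ₗ[ℂ] ℂ) {ξ : Mat2} (hξ : ξ.trace = 0) :
    Z ξ = ξ 0 0 * Z hMat + ξ 0 1 * Z eMat + ξ 1 0 * Z fMat := by
  have h : ξ = ξ 0 0 • hMat + ξ 0 1 • eMat + ξ 1 0 • fMat := by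
    rw [Matrix.trace_fin_two] at hξ
    ext i j
    fin_cases i <;> fin_cases j <;> simp [hMat, eMat, fMat]
    linear_combination hξ
  conv_lhs => rw [h]
  simp only [map_add, map_smul, smul_eq_mul]

theorem trace_firstLeg (M : Mat2) (j l : Fin 2) : (firstLeg M j l).trace = 0 := by
  simp only [Matrix.trace_fin_two, firstLeg_apply, Fin.sum_univ_two]
  fin_cases j <;> fin_cases l <;>
  simp [rPlus, rMinus, rMat, tMat, eMat, fMat, hMat]

/-- The element of `𝔤*` which represents a linear functional on `𝔤`. -/
def dualElement (Z : Mat2 →ₗ[ℂ] ℂ) : Mat2 × Mat2 :=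
  -- These are X₊ = -(Z ⊗ 1)(r₋) and X₋ = -(Z ⊗ 1)(r₊), with r₋ = -½ h ⊗ h - 2 f ⊗ e.
  (!![Z hMat / 2, 2 * Z fMat; 0, -(Z hMat / 2)], !![-(Z hMat / 2), 0; -(2 * Z eMat), Z hMat / 2])

theorem dualElement_mem (Z : Mat2 →ₗ[ℂ] ℂ) : dualElement Z ∈ dualLie := by
  refine ⟨?_, ?_, ?_, ?_, fun i => ?_⟩
  on_goal 5 => fin_cases i
  all_goals simp [dualElement, Matrix.trace_fin_two]

theorem dualPairing_dualElement (Z : Mat2 →ₗ[ℂ] ℂ) {ξ : Mat2} (hξ : ξ.trace = 0) :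
    dualPairing (dualElement Z) ξ = Z ξ := by
  rw [apply_of_trace_eq_zero Z hξ]
  rw [Matrix.trace_fin_two] at hξ
  simp only [dualPairing, dualElement, Matrix.trace_fin_two, Matrix.mul_apply, Fin.sum_univ_two]
  simp
  linear_combination (-1 / 2 * Z hMat) * hξ

/-- Applying Z to the first leg of M₂r₊ - r₋M₂ leaves M(Z ⊗ 1)(r₊) - (Z ⊗ 1)(r₋)M, that is, -MX₋ +
X₊M. -/
theorem apply_firstLeg (Z : Mat2 →ₗ[ℂ] ℂ) (M : Mat2) (j l : Fin 2) :
    Z (firstLeg M j l) = ((dualElement Z).1 * M - M * (dualElement Z).2) j l := by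
  rw [apply_of_trace_eq_zero Z (trace_firstLeg M j l)]
  simp only [firstLeg_apply, dualElement, Matrix.sub_apply, Matrix.mul_apply, Fin.sum_univ_two]
  fin_cases j <;> fin_cases l <;>
  simp [rPlus, rMinus, rMat, tMat, eMat, fMat, hMat] <;> ring

/-- The entry `M 1 1` is the pivot. Entry (1, 1) of X₊M - MX₋ is 2 `M 1 1` times the lower diagonal
entry of X₊, which determines both diagonals; entries (0, 1) and (1, 0) then determine the
off-diagonal parts. -/
theorem isDualLift_unique {M N : Mat2} (hM : M 1 1 ≠ 0) {X Y : Mat2 × Mat2}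
    (hX : IsDualLift M N X) (hY : IsDualLift M N Y) : X = Y := by
  obtain ⟨⟨h1, h2, h3, h4, h5⟩, hN⟩ := hX
  obtain ⟨⟨k1, k2, k3, k4, k5⟩, hN'⟩ := hY
  have e := fun i j => congrFun (congrFun (hN.symm.trans hN') i) j
  have e11 := e 1 1
  have e01 := e 0 1
  have e10 := e 1 0
  rw [Matrix.trace_fin_two] at h1 h2 k1 k2
  simp only [Matrix.sub_apply, Matrix.mul_apply, Fin.sum_univ_two] at e11 e01 e10
  have h50 := h5 0
  have h51 := h5 1
  have k50 := k5 0
  have k51 := k5 1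
  have d : X.1 1 1 = Y.1 1 1 := by
    refine mul_right_cancel₀ hM ?_
    rw [h3, h4, k3, k4] at e11
    linear_combination e11 / 2 + M 1 1 * (h51 - k51) / 2
  have d0 : X.1 0 0 = Y.1 0 0 := by linear_combination h1 - k1 - d
  have d' : X.2 1 1 = Y.2 1 1 := by linear_combination h51 - k51 - d
  have d0' : X.2 0 0 = Y.2 0 0 := by linear_combination h50 - k50 - d0
  have u : X.1 0 1 = Y.1 0 1 := by
    refine mul_right_cancel₀ hM ?_
    rw [h4, k4, d', d0] at e01
    linear_combination e01
  have v : X.2 1 0 = Y.2 1 0 := by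
    refine mul_right_cancel₀ hM ?_
    rw [h3, k3, d, d0'] at e10
    linear_combination -e10
  refine Prod.ext ?_ ?_ <;> ext i j <;> fin_cases i <;> fin_cases j
  · exact d0
  · exact u
  · exact h3.trans k3.symm
  · exact d
  · exact d0'
  · exact h4.trans k4.symm
  · exact v
  · exact d'

theorem factorMap_apply_one_one_ne_zero (b : dualGroup) : (factorMap b : Mat2) 1 1 ≠ 0 := by
  obtain ⟨α, δ, u, v, h, hp, hm⟩ := exists_dualGroup_coords b
  simpa [factorMap, hp, hm, Matrix.adjugate_fin_two] using right_ne_zero_of_mul_eq_one h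

theorem isPoissonMapToDual {a : 𝓓(window, ℂ) →L[ℂ] ℂ} (hB : B.HasExchangeRelations h𝒜 a) :
    B.IsPoissonMapToDual h𝒜 := by
  refine ⟨bracket_pullback h𝒜 B hB, fun P Q p b hb => ?_⟩
  rw [bracket_pullback h𝒜 B hB, biderivation_bind₁, ← hb]
  simp only [biderivation_factorPoly, eval_factorPoly]

theorem isMomentMap {a : 𝓓(window, ℂ) →L[ℂ] ℂ} (hB : B.HasExchangeRelations h𝒜 a) :
    B.IsMomentMap h𝒜 := by
  refine ⟨isPoissonMapToDual h𝒜 B hB, fun F p => ?_⟩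
  obtain ⟨D, hD⟩ := h𝒜.differentiable F.1 F.2 p
  have hlift : IsDualLift p.M (Matrix.of fun i j => (B.bracket F (monodromyObs h𝒜 (i, j))).1 p)
      (dualElement (D ∘ₗ actionVector p)) := by
    refine ⟨dualElement_mem _, Matrix.ext fun j l => ?_⟩
    obtain ⟨X, hX⟩ := B.hamiltonian (monodromyObs h𝒜 (j, l)) p
    -- The crux of the moment map property: the Hamiltonian vector of a matrix coefficient is an
    -- infinitesimal action vector, with Lie algebra element depending on M.
    have hXa : X = actionVector p (firstLeg p.M j l) := by
      refine Subtype.ext (Prod.ext (funext fun x => funext fun k => ?_) ?_)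
      · exact hamiltonianVector_apply h𝒜 B hB j l p X hX x k
      · exact hamiltonianVector_snd h𝒜 B hB j l p X hX
    rw [Matrix.of_apply, hX F D hD, hXa, ← apply_firstLeg]
    rfl
  refine ⟨⟨_, hlift, fun g ξ hg h0 hξ => ?_⟩, ?_⟩
  · obtain ⟨htr, h⟩ := hasDerivAt_act hD hg h0 hξ
    rw [dualPairing_dualElement _ htr]
    exact h
  · rintro ⟨b, hb⟩
    refine ⟨_, hlift, fun Y hY => isDualLift_unique ?_ hY hlift⟩
    rw [← hb]
    exact factorMap_apply_one_one_ne_zero b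

end WaveFunctions

end

open WaveFunctions in
theorem mainTheorem5 (𝒜 : Subalgebra ℂ (WaveSpace → ℂ)) (h𝒜 : IsObservableAlgebra 𝒜)
    (B : PoissonBracket 𝒜) (a : 𝓓(window, ℂ) →L[ℂ] ℂ) (hB : B.HasExchangeRelations h𝒜 a) :
    -- `{w(x)₁, M₂} = w(x)₁ [M₂ r₊ - r₋ M₂]`, smeared with a test function `f`
    (∀ (f : Test) (k j l : Fin 2) (p : WaveSpace),
      (B.bracket ⟨smeared f k, h𝒜.smeared_mem f k⟩ (monodromyObs h𝒜 (j, l))).1 p =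
        ∫ x, f x * rowLeg₁ (p.w x) (leg₂ p.M * rPlus - rMinus * leg₂ p.M) k j l) ∧
    -- the same pointwise in `x`: the variation of `w_k(x)` under the Hamiltonian vector field
    (∀ (j l : Fin 2) (p : WaveSpace) (X : tangentSpace p),
      B.IsHamiltonianVector (monodromyObs h𝒜 (j, l)) p X → ∀ (x : ℝ) (k : Fin 2),
        X.1.1 x k = rowLeg₁ (p.w x) (leg₂ p.M * rPlus - rMinus * leg₂ p.M) k j l) ∧
    -- `{M₁, M₂} = M₁M₂ r + r M₁M₂ - M₂ r₊ M₁ - M₁ r₋ M₂`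
    (∀ (i k j l : Fin 2) (p : WaveSpace),
      (B.bracket (monodromyObs h𝒜 (i, k)) (monodromyObs h𝒜 (j, l))).1 p =
        (leg₁ p.M * leg₂ p.M * rMat + rMat * leg₁ p.M * leg₂ p.M
          - leg₂ p.M * rPlus * leg₁ p.M - leg₁ p.M * rMinus * leg₂ p.M) (i, j) (k, l)) ∧
    -- `μ : (w, M) ↦ M` is a Poisson map into `G*`, and the moment map of the right action of `G`
    B.IsPoissonMapToDual h𝒜 ∧ B.IsMomentMap h𝒜 :=
  ⟨bracket_smeared_monodromy h𝒜 B hB, hamiltonianVector_apply h𝒜 B hB,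
    bracket_monodromy h𝒜 B hB, isPoissonMapToDual h𝒜 B hB, isMomentMap h𝒜 B hB⟩
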